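/- **Setting.** Let $\mathcal H$ be a complex Hilbert space and let $\mathcal X\subseteq\mathcal H$ be a dense subspace with a stronger norm (that is, $\mathcal X$ is a normed space, continuously, injectively and densely embedded in $\mathcal H$). Let $\mathcal X^*$ be the space of bounded antilinear functionals on $\mathcal X$, so that $\mathcal X\subseteq\mathcal H\subseteq\mathcal X^*$ by $h\mapsto (h,\cdot)_{\mathcal H}$. Let $\mathcal X^*_H\subseteq\mathcal X^*$ be a densely and continuously embedded Banach space. Let $H$ be a self-adjoint operator in $\mathcal H$ with spectral measure $E$; write $E(\lambda)=E((-\infty,\lambda))$, $R(z)=(H-z)^{-1}$ for $\operatorname{Im}z\neq0$, and $P_{ac}(H)$ for the projection on the absolutely continuous subspace. Let $J\subseteq\mathbb R$ be open with $P_{ac}(H)E(J)=E(J)$. Assume that the weak spectral derivative $A(\lambda)$, $\lambda\in J$, given by $$\langle A(\lambda)f,g\rangle=\frac{d}{d\lambda}\big(E(\lambda)P_{ac}(H)f,g\big)_{\mathcal H},\qquad f,g\in\mathcal X,$$ exists in $B(\mathcal X,\mathcal X^*_H)$ and is locally Hölder continuous on $J$ in the norm of $B(\mathcal X,\mathcal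 X^*_H)$. Assume moreover that for every interval $K=[a,b]\subseteq J$, $a<b$, the operator $R(z)E(\mathbb R\setminus K)$ (where, for real $z\in(a,b)$, $R(z)$ denotes the inverse of $H-z$ on the range of $E(\mathbb R\setminus K)$) maps $\mathcal X$ into $\mathcal X^*_H$ and is continuous in $z\in(\mathbb C\setminus\mathbb R)\cup(a,b)$ in the norm of $B(\mathcal X,\mathcal X^*_H)$; this holds automatically if $\mathcal X^*_H=\mathcal X^*$. Under these assumptions the limits $R^\pm(\lambda)=\lim_{\varepsilon\downarrow0}R(\lambda\pm i\varepsilon)$, $\lambda\in J$, exist in the norm of $B(\mathcal X,\mathcal X^*_H)$. Let $V:\mathcal X^*_H\to\mathcal X$ be a compact linear operator such that $\mathcal D=D(H)\cap\mathcal X^*_H$ is dense in $\mathcal H$, the restriction of $V$ to $\mathcal D$ is symmetric in $\mathcal H$, and there are $z\in\mathbb C$ with $\operatorname{Im}z\neq0$ and a linear subspace $\mathcal D_z\subseteq\mathcal D$ such that $(H-z)\mathcal D_z$ is contained and dense in $\mathcal X$. Let $\widetilde H$ be the self-adjoint extension of $H+V$ defined on $\mathcal D$, with spectral measure $\widetilde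 E$ and $\widetilde E(\lambda)=\widetilde E((-\infty,\lambda))$. **Proposition.** Assume that for every $\lambda\in J$ and both signs the operator $I+VR^\pm(\lambda)$ is invertible in $B(\mathcal X)$, and that $$\sup_{\lambda\in J}\big\|[I+VR^\pm(\lambda)]^{-1}\big\|_{B(\mathcal X)}<\infty .$$ Then the weak derivative $\widetilde A(\lambda)=\frac{d}{d\lambda}\widetilde E(\lambda)$ exists in $B(\mathcal X,\mathcal X^*)$ for every $\lambda\in J$, that is, $\langle\widetilde A(\lambda)f,g\rangle=\frac{d}{d\lambda}(\widetilde E(\lambda)f,g)_{\mathcal H}$ for all $f,g\in\mathcal X$. There is a constant $C>0$, independent of $\lambda$, such that $$\|\widetilde A(\lambda)\|_{B(\mathcal X,\mathcal X^*)}\le C\,\|A(\lambda)\|_{B(\mathcal X,\mathcal X^*)},\qquad\lambda\in J,$$ and, for every $\lambda\in J$, $$\widetilde A(\lambda)=A(\lambda)\,[I+VR^+(\lambda)]^{-1}-R^-(\lambda)\,[I+VR^+(\lambda)]^{-1}\,V A(\lambda)\,[I+VR^-(\lambda)]^{-1}.$$ -/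

import Mathlib

open MeasureTheory Filter Topology Set
open scoped NNReal ENNReal

namespace SpectralPerturbation

noncomputable section

/-- A projection-valued (spectral) measure on the Borel sets of the real line, acting on the
Hilbert space `𝓗`. Values at non-measurable sets are irrelevant. -/
structure SpectralMeasure (𝓗 : Type*) [NormedAddCommGroup 𝓗] [InnerProductSpace ℂ 𝓗]
    [CompleteSpace 𝓗] where
  toFun : Set ℝ → 𝓗 →L[ℂ] 𝓗
  isStarProjection : ∀ S, MeasurableSet S → IsStarProjection (toFun S)
  map_univ : toFun univ = 1
  map_inter : ∀ S T, MeasurableSet S → MeasurableSet T → toFun (S ∩ T) = toFun S * toFun T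
  hasSum_iUnion : ∀ S : ℕ → Set ℝ, (∀ n, MeasurableSet (S n)) →
    Pairwise (Function.onFun Disjoint S) → ∀ f : 𝓗,
    HasSum (fun n => toFun (S n) f) (toFun (⋃ n, S n) f)

namespace SpectralMeasure

variable {𝓗 : Type*} [NormedAddCommGroup 𝓗] [InnerProductSpace ℂ 𝓗] [CompleteSpace 𝓗]

instance : CoeFun (SpectralMeasure 𝓗) (fun _ => Set ℝ → 𝓗 →L[ℂ] 𝓗) := ⟨toFun⟩

theorem inner_apply_self (E : SpectralMeasure 𝓗) {S : Set ℝ} (hS : MeasurableSet S) (f : 𝓗) :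
    inner ℂ f (E S f) = ((‖E S f‖ ^ 2 : ℝ) : ℂ) := by
  have h := E.isStarProjection S hS
  have h1 : E S (E S f) = E S f := congrArg (fun T : 𝓗 →L[ℂ] 𝓗 => T f) h.isIdempotentElem
  have h2 : ContinuousLinearMap.adjoint (E S) = E S := h.isSelfAdjoint
  calc inner ℂ f (E S f) = inner ℂ f (E S (E S f)) := by rw [h1]
    _ = inner ℂ (ContinuousLinearMap.adjoint (E S) f) (E S f) := by
        rw [ContinuousLinearMap.adjoint_inner_left]
    _ = inner ℂ (E S f) (E S f) := by rw [h2]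
    _ = ((‖E S f‖ ^ 2 : ℝ) : ℂ) := by rw [inner_self_eq_norm_sq_to_K]; norm_cast

theorem map_empty (E : SpectralMeasure 𝓗) (f : 𝓗) : E ∅ f = 0 := by
  have h := E.hasSum_iUnion (fun _ => ∅) (fun _ => MeasurableSet.empty)
    (fun _ _ _ => disjoint_bot_left) f
  have h0 := h.summable.tendsto_atTop_zero
  exact tendsto_nhds_unique tendsto_const_nhds h0

/-- The scalar spectral measure `S ↦ (E(S) f, f) = ‖E(S) f‖²` of the vector `f`. -/
def scalar (E : SpectralMeasure 𝓗) (f : 𝓗) : Measure ℝ :=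
  Measure.ofMeasurable (fun S _ => ENNReal.ofReal (‖E S f‖ ^ 2))
    (by simp [map_empty])
    (by
      intro S hS hd
      have h := E.hasSum_iUnion S hS hd f
      have h1 := (h.mapL (innerSL ℂ f)).mapL Complex.reCLM
      have h2 : HasSum (fun n => ‖E (S n) f‖ ^ 2) (‖E (⋃ n, S n) f‖ ^ 2) := by
        have e : ∀ T, MeasurableSet T →
            Complex.reCLM (innerSL ℂ f (E T f)) = ‖E T f‖ ^ 2 := by
          intro T hT
          rw [innerSL_apply_apply, inner_apply_self E hT, Complex.reCLM_apply, Complex.ofReal_re]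
        rw [← e _ (MeasurableSet.iUnion hS)]
        refine h1.congr_fun ?_
        intro n
        exact (e _ (hS n)).symm
      rw [← h2.tsum_eq]
      exact ENNReal.ofReal_tsum_of_nonneg (fun n => by positivity) h2.summable)

/-- The absolutely continuous subspace: the closed subspace generated by (in fact, equal to the
set of) the vectors whose scalar spectral measure is absolutely continuous with respect to
Lebesgue measure. -/
def acSubspace (E : SpectralMeasure 𝓗) : Submodule ℂ 𝓗 :=
  (Submodule.span ℂ {f : 𝓗 | E.scalar f ≪ volume}).topologicalClosure

/-- The orthogonal projection `P_ac` on the absolutely continuous subspace. -/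
def acProjection (E : SpectralMeasure 𝓗) : 𝓗 →L[ℂ] 𝓗 :=
  haveI : CompleteSpace E.acSubspace :=
    (Submodule.isClosed_topologicalClosure _).completeSpace_coe
  E.acSubspace.starProjection

/-- `E` is the spectral measure of the operator `H`, i.e. `H = ∫ t dE(t)`: the domain of `H`
consists of the `f` with `∫ t² d(E(t)f,f) < ∞`, and `(H f, f) = ∫ t d(E(t)f,f)` on the domain. -/
def IsSpectralMeasureOf (E : SpectralMeasure 𝓗) (H : 𝓗 →ₗ.[ℂ] 𝓗) : Prop :=
  (∀ f : 𝓗, f ∈ H.domain ↔ Integrable (fun t : ℝ => t ^ 2) (E.scalar f)) ∧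
  ∀ f : H.domain, inner ℂ (f : 𝓗) (H f) = ((∫ t, t ∂(E.scalar (f : 𝓗)) : ℝ) : ℂ)

end SpectralMeasure

/-- The dual `𝒳*`: bounded antilinear functionals on `𝒳`, so that the canonical inclusion
`𝓗 ⊆ 𝒳*`, `h ↦ (h, ·)`, is linear. -/
abbrev AntiDual (𝒳 : Type*) [NormedAddCommGroup 𝒳] [NormedSpace ℂ 𝒳] : Type _ := 𝒳 →L⋆[ℂ] ℂ

section Setup

variable {𝓗 : Type*} [NormedAddCommGroup 𝓗] [InnerProductSpace ℂ 𝓗] [CompleteSpace 𝓗]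
variable {𝒳 : Type*} [NormedAddCommGroup 𝒳] [NormedSpace ℂ 𝒳]
variable {𝒴 : Type*} [NormedAddCommGroup 𝒴] [NormedSpace ℂ 𝒴]

/-- The canonical inclusion `𝓗 → 𝒳*`, `⟨h, g⟩ = (h, ι g)` (linear in `h`, antilinear in `g`; the
scalar product of Mathlib is antilinear in its first argument). -/
def toAntiDual (ι : 𝒳 →L[ℂ] 𝓗) : 𝓗 →L[ℂ] AntiDual 𝒳 :=
  ((innerSL ℂ (E := 𝓗)).comp ι).flip

/-- `B` is the weak derivative at `t₀` of the operator function `F`: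
`⟨B f, g⟩ = d/dt (F(t) f, g)` at `t = t₀`, for all `f, g ∈ 𝒳`. -/
def HasWeakDerivAt (ι : 𝒳 →L[ℂ] 𝓗) (F : ℝ → 𝓗 →L[ℂ] 𝓗) (B : 𝒳 →L[ℂ] AntiDual 𝒳)
    (t₀ : ℝ) : Prop :=
  ∀ f g : 𝒳, HasDerivAt (fun t : ℝ => inner ℂ (ι g) (F t (ι f))) (B f g) t₀

/-- Local Hölder continuity on `J`. -/
def LocallyHolderOn {Z : Type*} [PseudoEMetricSpace Z] (A : ℝ → Z) (J : Set ℝ) : Prop :=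
  ∀ t ∈ J, ∃ U ∈ 𝓝 t, ∃ C r : ℝ≥0, 0 < r ∧ HolderOnWith C r A (U ∩ J)

/-- `T : 𝒳 → 𝒴` is the restriction to `𝒳` of the operator `(H - z)⁻¹ P` on `𝓗`, where `P` is a
spectral projection of `H` and `(H - z)⁻¹` is the inverse of `H - z` on the range of `P`; here
`𝒴` is embedded in `𝒳*` by `j`. -/
def IsResolventRestriction (H : 𝓗 →ₗ.[ℂ] 𝓗) (ι : 𝒳 →L[ℂ] 𝓗) (j : 𝒴 →L[ℂ] AntiDual 𝒳)
    (P : 𝓗 →L[ℂ] 𝓗) (z : ℂ) (T : 𝒳 →L[ℂ] 𝒴) : Prop :=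
  ∀ f : 𝒳, ∃ u : H.domain, P (u : 𝓗) = u ∧ H u - z • (u : 𝓗) = P (ι f) ∧
    j (T f) = toAntiDual ι (u : 𝓗)

/-- For every compact interval `K = [a, b] ⊆ J`, the part `R(z) E(ℝ \ K)` of the resolvent maps
`𝒳` to `𝒴` and depends continuously, in the norm of `B(𝒳, 𝒴)`, on
`z ∈ (ℂ \ ℝ) ∪ (a, b)`. -/
def OffSpectrumRegular (H : 𝓗 →ₗ.[ℂ] 𝓗) (E : SpectralMeasure 𝓗) (ι : 𝒳 →L[ℂ] 𝓗)
    (j : 𝒴 →L[ℂ] AntiDual 𝒳) (J : Set ℝ) : Prop :=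
  ∀ a b : ℝ, a < b → Icc a b ⊆ J → ∃ S : ℂ → 𝒳 →L[ℂ] 𝒴,
    ContinuousOn S {z : ℂ | z.im ≠ 0 ∨ z.re ∈ Ioo a b} ∧
    ∀ z : ℂ, (z.im ≠ 0 ∨ z.re ∈ Ioo a b) →
      IsResolventRestriction H ι j (E (Icc a b)ᶜ) z (S z)

open scoped Classical in
/-- The resolvent `R(z) = (H - z)⁻¹`, `Im z ≠ 0`, as an element of `B(𝒳, 𝒴)`. -/
def resolventXY (H : 𝓗 →ₗ.[ℂ] 𝓗) (ι : 𝒳 →L[ℂ] 𝓗) (j : 𝒴 →L[ℂ] AntiDual 𝒳) (z : ℂ) :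
    𝒳 →L[ℂ] 𝒴 :=
  if h : ∃ T : 𝒳 →L[ℂ] 𝒴, IsResolventRestriction H ι j 1 z T then h.choose else 0

/-- The boundary value `R⁺(t) = lim R(t + iε)`, `ε ↓ 0`, in the norm of `B(𝒳, 𝒴)`. -/
def resolventPlus (H : 𝓗 →ₗ.[ℂ] 𝓗) (ι : 𝒳 →L[ℂ] 𝓗) (j : 𝒴 →L[ℂ] AntiDual 𝒳) (t : ℝ) :
    𝒳 →L[ℂ] 𝒴 :=
  limUnder (𝓝[>] (0 : ℝ)) (fun ε : ℝ => resolventXY H ι j ((t : ℂ) + (ε : ℂ) * Complex.I))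

/-- The boundary value `R⁻(t) = lim R(t - iε)`, `ε ↓ 0`, in the norm of `B(𝒳, 𝒴)`. -/
def resolventMinus (H : 𝓗 →ₗ.[ℂ] 𝓗) (ι : 𝒳 →L[ℂ] 𝓗) (j : 𝒴 →L[ℂ] AntiDual 𝒳) (t : ℝ) :
    𝒳 →L[ℂ] 𝒴 :=
  limUnder (𝓝[>] (0 : ℝ)) (fun ε : ℝ => resolventXY H ι j ((t : ℂ) - (ε : ℂ) * Complex.I))

/-- The subspace `𝒟 = D(H) ∩ 𝒴` of `𝓗`, the intersection being taken in `𝒳*`. -/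
def commonDomain (H : 𝓗 →ₗ.[ℂ] 𝓗) (ι : 𝒳 →L[ℂ] 𝓗) (j : 𝒴 →L[ℂ] AntiDual 𝒳) :
    Submodule ℂ 𝓗 :=
  H.domain ⊓ (LinearMap.range j.toLinearMap).comap (toAntiDual ι).toLinearMap

/-- `V : 𝒴 → 𝒳` is short-range and symmetric with respect to `H`. -/
structure IsShortRangeSymmetric (H : 𝓗 →ₗ.[ℂ] 𝓗) (ι : 𝒳 →L[ℂ] 𝓗) (j : 𝒴 →L[ℂ] AntiDual 𝒳)
    (V : 𝒴 →L[ℂ] 𝒳) : Prop where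
  compact : IsCompactOperator V
  dense : Dense (commonDomain H ι j : Set 𝓗)
  symmetric : ∀ u ∈ commonDomain H ι j, ∀ v ∈ commonDomain H ι j, ∀ y w : 𝒴,
    j y = toAntiDual ι u → j w = toAntiDual ι v →
      inner ℂ (ι (V y)) v = inner ℂ u (ι (V w))
  dense_range : ∃ z : ℂ, z.im ≠ 0 ∧ ∃ D : Submodule ℂ 𝓗, D ≤ commonDomain H ι j ∧
    (∀ u : H.domain, (u : 𝓗) ∈ D → H u - z • (u : 𝓗) ∈ Set.range ι) ∧
    Dense {f : 𝒳 | ∃ u : H.domain, (u : 𝓗) ∈ D ∧ H u - z • (u : 𝓗) = ι f}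

/-- `H'` extends the operator `H + V` defined on `𝒟 = D(H) ∩ 𝒴`. -/
def ExtendsSum (H : 𝓗 →ₗ.[ℂ] 𝓗) (ι : 𝒳 →L[ℂ] 𝓗) (j : 𝒴 →L[ℂ] AntiDual 𝒳) (V : 𝒴 →L[ℂ] 𝒳)
    (H' : 𝓗 →ₗ.[ℂ] 𝓗) : Prop :=
  ∀ (u : H.domain) (y : 𝒴), j y = toAntiDual ι (u : 𝓗) →
    ∃ v : H'.domain, (v : 𝓗) = u ∧ H' v = H u + ι (V y)

end Setup

end

end SpectralPerturbation

/-! The proof is Stieltjes inversion applied to the perturbed resolvent `R(z)(1 + V R(z))⁻¹`.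

Near `t ∈ J` choose a compact interval `K ⊆ J` around `t`. The resolvent of `H` is its part off `K`,
continuous across `K`'s interior, plus the Cauchy integral of `A` over `K`. Hölder continuity of `A`
yields Plemelj limits `Q ± πi A(t)` as `z → t` from above and below, unrestricted in the approach
(`exists_boundary_values`). Hence `R⁺ - R⁻ = 2πi A`. Since `V` is compact, `(1 + V R(z))⁻¹` exists
near `t` and converges to `B± = (1 + V R±)⁻¹`, although `𝒳` need not be complete
(`tendsto_ringInverse_one_add`).

Put `p = (1 + V R(z))⁻¹ h` and `u = R(z) p`. Then `(H - z) u = p` and `(H' - z) u = h`. So `⟨u, h⟩`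
is the Stieltjes transform of the scalar spectral measure of `h` for `H'`, and its imaginary part is
a Poisson integral. Its convergence on a full half-neighbourhood of `t` makes the distribution
function differentiable at `t`, with derivative `π⁻¹ Im ⟨R⁺B⁺h, h⟩`
(`hasDerivAt_measure_Iio_of_tendsto_poisson`).

This number is rewritten in two ways in `perturbed_density_at`. The jump `R⁺B⁺ - R⁻B⁻`, computed
with the resolvent identity, gives the stated formula. On the other hand `Im ⟨u, h⟩ = Im z ‖u‖² = Im
⟨u, p⟩`, because `H` and `H'` are both symmetric; in the limit the density is `⟨A B⁺h, B⁺h⟩`, and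
the norm bound follows by polarization. Diagonal identities suffice throughout, since complex
sesquilinear forms are determined by their diagonals. -/

namespace SpectralPerturbation

/-! ### Algebra of a spectral measure and its scalar measures. -/

namespace SpectralMeasure

variable {𝓗 : Type*} [NormedAddCommGroup 𝓗] [InnerProductSpace ℂ 𝓗] [CompleteSpace 𝓗]

theorem scalar_apply (E : SpectralMeasure 𝓗) (f : 𝓗) {S : Set ℝ} (hS : MeasurableSet S) :
    E.scalar f S = ENNReal.ofReal (‖E S f‖ ^ 2) :=
  Measure.ofMeasurable_apply S hS

theorem map_univ_apply (E : SpectralMeasure 𝓗) (f : 𝓗) : E univ f = f := by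
  rw [E.map_univ]; rfl

instance isFiniteMeasure_scalar (E : SpectralMeasure 𝓗) (f : 𝓗) :
    IsFiniteMeasure (E.scalar f) :=
  ⟨by rw [scalar_apply E f MeasurableSet.univ]; exact ENNReal.ofReal_lt_top⟩

theorem scalar_real (E : SpectralMeasure 𝓗) (f : 𝓗) {S : Set ℝ} (hS : MeasurableSet S) :
    (E.scalar f).real S = ‖E S f‖ ^ 2 := by
  rw [Measure.real, scalar_apply E f hS, ENNReal.toReal_ofReal (by positivity)]

theorem apply_apply (E : SpectralMeasure 𝓗) {S T : Set ℝ} (hS : MeasurableSet S)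
    (hT : MeasurableSet T) (f : 𝓗) : E S (E T f) = E (S ∩ T) f := by
  rw [E.map_inter S T hS hT]; rfl

theorem apply_apply_self (E : SpectralMeasure 𝓗) {S : Set ℝ} (hS : MeasurableSet S) (f : 𝓗) :
    E S (E S f) = E S f := by
  rw [apply_apply E hS hS, inter_self]

theorem apply_apply_disjoint (E : SpectralMeasure 𝓗) {S T : Set ℝ} (hS : MeasurableSet S)
    (hT : MeasurableSet T) (h : Disjoint S T) (f : 𝓗) : E S (E T f) = 0 := by
  rw [apply_apply E hS hT, h.inter_eq, map_empty]

theorem adjoint_apply (E : SpectralMeasure 𝓗) {S : Set ℝ} (hS : MeasurableSet S) :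
    ContinuousLinearMap.adjoint (E S) = E S :=
  (E.isStarProjection S hS).isSelfAdjoint

theorem inner_apply_left (E : SpectralMeasure 𝓗) {S : Set ℝ} (hS : MeasurableSet S) (f g : 𝓗) :
    inner ℂ (E S f) g = inner ℂ f (E S g) := by
  rw [← ContinuousLinearMap.adjoint_inner_left, adjoint_apply E hS]

theorem apply_union (E : SpectralMeasure 𝓗) {S T : Set ℝ} (hS : MeasurableSet S)
    (hT : MeasurableSet T) (h : Disjoint S T) (f : 𝓗) : E (S ∪ T) f = E S f + E T f := by
  have hsum := E.hasSum_iUnion (fun n : ℕ => if n = 0 then S else if n = 1 then T else ∅)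
    (fun n => by split_ifs <;> simp [hS, hT]) (by
      intro m n hmn
      simp only [Function.onFun]
      split_ifs <;> simp_all [h.symm]) f
  have hU : (⋃ n : ℕ, if n = 0 then S else if n = 1 then T else ∅) = S ∪ T := by
    ext x
    simp only [mem_iUnion, mem_union]
    constructor
    · rintro ⟨n, hn⟩
      split_ifs at hn <;> simp_all
    · rintro (hx | hx)
      · exact ⟨0, by simpa⟩
      · exact ⟨1, by simpa⟩
  rw [hU] at hsum
  have hfin := hasSum_sum_of_ne_finset_zero (s := Finset.range 2)
    (L := SummationFilter.unconditional ℕ)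
    (f := fun n : ℕ => E (if n = 0 then S else if n = 1 then T else ∅) f) (by
      intro n hn
      simp only [Finset.mem_range, not_lt] at hn
      have h0 : n ≠ 0 := by omega
      have h1 : n ≠ 1 := by omega
      simp [h0, h1, map_empty])
  have := hsum.unique hfin
  simpa [Finset.sum_range_succ] using this

theorem apply_add_compl (E : SpectralMeasure 𝓗) {S : Set ℝ} (hS : MeasurableSet S) (f : 𝓗) :
    E S f + E Sᶜ f = f := by
  rw [← apply_union E hS hS.compl disjoint_compl_right, union_compl_self, map_univ_apply]

theorem scalar_map (E : SpectralMeasure 𝓗) {S : Set ℝ} (hS : MeasurableSet S) (f : 𝓗) :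
    E.scalar (E S f) = (E.scalar f).restrict S := by
  ext T hT
  rw [Measure.restrict_apply hT, scalar_apply E _ hT, scalar_apply E _ (hT.inter hS),
    apply_apply E hT hS]

theorem scalar_add_compl (E : SpectralMeasure 𝓗) {S : Set ℝ} (hS : MeasurableSet S) (f g : 𝓗) :
    E.scalar (E S f + E Sᶜ g) = (E.scalar f).restrict S + (E.scalar g).restrict Sᶜ := by
  ext T hT
  rw [Measure.add_apply, Measure.restrict_apply hT, Measure.restrict_apply hT,
    scalar_apply E _ hT, scalar_apply E _ (hT.inter hS), scalar_apply E _ (hT.inter hS.compl),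
    ← ENNReal.ofReal_add (by positivity) (by positivity)]
  congr 1
  rw [map_add, apply_apply E hT hS, apply_apply E hT hS.compl]
  have h0 : inner ℂ (E (T ∩ S) f) (E (T ∩ Sᶜ) g) = 0 := by
    rw [inner_apply_left E (hT.inter hS), apply_apply_disjoint E (hT.inter hS)
      (hT.inter hS.compl), inner_zero_right]
    exact disjoint_compl_right.mono inter_subset_right inter_subset_right
  have := norm_add_sq_eq_norm_sq_add_norm_sq_of_inner_eq_zero (𝕜 := ℂ) _ _ h0
  simp only [sq]
  exact this

variable {E : SpectralMeasure 𝓗} {H : 𝓗 →ₗ.[ℂ] 𝓗}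

theorem IsSpectralMeasureOf.mem_domain_iff (hE : E.IsSpectralMeasureOf H) {f : 𝓗} :
    f ∈ H.domain ↔ Integrable (fun t : ℝ => t ^ 2) (E.scalar f) := hE.1 f

theorem IsSpectralMeasureOf.inner_graph (hE : E.IsSpectralMeasureOf H) {u w : 𝓗}
    (h : (u, w) ∈ H.graph) : inner ℂ u w = ((∫ t, t ∂(E.scalar u) : ℝ) : ℂ) := by
  obtain ⟨v, rfl, rfl⟩ := (LinearPMap.mem_graph_iff _).1 h
  exact hE.2 v

theorem IsSpectralMeasureOf.integrable_id (hE : E.IsSpectralMeasureOf H) {u : 𝓗}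
    (h : u ∈ H.domain) : Integrable (fun t : ℝ => t) (E.scalar u) := by
  refine ((integrable_const (1 : ℝ)).add (hE.mem_domain_iff.1 h)).mono' (by fun_prop)
    (ae_of_all _ fun t => ?_)
  simp only [Pi.add_apply, Real.norm_eq_abs]
  rw [abs_le]
  constructor <;> nlinarith [sq_nonneg (t - 1), sq_nonneg (t + 1)]

theorem IsSpectralMeasureOf.map_mem_domain (hE : E.IsSpectralMeasureOf H) {S : Set ℝ}
    (hS : MeasurableSet S) {u : 𝓗} (h : u ∈ H.domain) : E S u ∈ H.domain := by
  rw [hE.mem_domain_iff, scalar_map E hS]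
  exact (hE.mem_domain_iff.1 h).restrict

end SpectralMeasure

/-! ### Self-adjoint operators through their graphs: symmetry and the resolvent. -/

section SelfAdjoint

variable {𝓗 : Type*} [NormedAddCommGroup 𝓗] [InnerProductSpace ℂ 𝓗] {H : 𝓗 →ₗ.[ℂ] 𝓗}

theorem exists_mem_graph {u : 𝓗} (h : u ∈ H.domain) : ∃ w, (u, w) ∈ H.graph :=
  ⟨H ⟨u, h⟩, H.mem_graph ⟨u, h⟩⟩

variable [CompleteSpace 𝓗]

theorem inner_graph_symm (hH : IsSelfAdjoint H) {u w v y : 𝓗} (h : (u, w) ∈ H.graph)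
    (h' : (v, y) ∈ H.graph) : inner ℂ w v = inner ℂ u y := by
  have hf := LinearPMap.adjoint_isFormalAdjoint hH.dense_domain
  rw [LinearPMap.isSelfAdjoint_def.1 hH] at hf
  obtain ⟨a, rfl, rfl⟩ := (LinearPMap.mem_graph_iff _).1 h
  obtain ⟨b, rfl, rfl⟩ := (LinearPMap.mem_graph_iff _).1 h'
  exact hf a b

theorem mem_graph_of_forall_inner (hH : IsSelfAdjoint H) {v g : 𝓗}
    (h : ∀ u w, (u, w) ∈ H.graph → inner ℂ w v = inner ℂ u g) : (v, g) ∈ H.graph := by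
  have hg := LinearPMap.adjoint_graph_eq_graph_adjoint hH.dense_domain
  rw [LinearPMap.isSelfAdjoint_def.1 hH] at hg
  rw [hg, Submodule.mem_adjoint_iff]
  intro a b hab
  rw [h a b hab, sub_self]

theorem im_inner_graph (hH : IsSelfAdjoint H) {u w : 𝓗} (h : (u, w) ∈ H.graph) (z : ℂ) :
    (inner ℂ (w - z • u) u).im = z.im * ‖u‖ ^ 2 := by
  have h1 : (inner ℂ w u).im = 0 := by
    have h2 := congrArg Complex.im (inner_conj_symm (𝕜 := ℂ) u w)
    rw [inner_graph_symm hH h h] at h2 ⊢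
    rw [← inner_graph_symm hH h h, Complex.conj_im] at h2
    rw [inner_graph_symm hH h h] at h2
    linarith
  rw [inner_sub_left, inner_smul_left, inner_self_eq_norm_sq_to_K, Complex.sub_im, h1]
  have : (starRingEnd ℂ) z * ((‖u‖ : ℝ) : ℂ) ^ 2 = (starRingEnd ℂ) z * ((‖u‖ ^ 2 : ℝ) : ℂ) := by
    norm_cast
  erw [this]
  rw [mul_comm, Complex.im_ofReal_mul, Complex.conj_im]
  ring

theorem norm_graph_le (hH : IsSelfAdjoint H) {u w : 𝓗} (h : (u, w) ∈ H.graph) (z : ℂ) :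
    |z.im| * ‖u‖ ≤ ‖w - z • u‖ := by
  have h1 := im_inner_graph hH h z
  have h2 := (Complex.abs_im_le_norm _).trans (norm_inner_le_norm (𝕜 := ℂ) (w - z • u) u)
  rw [h1, abs_mul, abs_of_nonneg (sq_nonneg ‖u‖), sq, ← mul_assoc] at h2
  rcases (norm_nonneg u).eq_or_lt with h0 | h0
  · rw [← h0]; simp
  · exact le_of_mul_le_mul_right h2 h0

theorem eq_of_graph (hH : IsSelfAdjoint H) {u w u' w' : 𝓗} {z : ℂ} (hz : z.im ≠ 0)
    (h : (u, w) ∈ H.graph) (h' : (u', w') ∈ H.graph) (he : w - z • u = w' - z • u') :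
    u = u' := by
  have h1 := norm_graph_le hH (H.graph.sub_mem h h') z
  have h2 : w - w' - z • (u - u') = 0 := by
    rw [smul_sub, sub_sub_sub_comm, he, sub_self]
  rw [h2, norm_zero] at h1
  have h3 : ‖u - u'‖ ≤ 0 := by
    have := abs_pos.2 hz
    by_contra hc
    push Not at hc
    have := mul_pos this hc
    exact absurd h1 (not_le.2 this)
  exact sub_eq_zero.1 (norm_le_zero_iff.1 h3)

/-- The lower bound `norm_graph_le` makes the range of `H - z` closed, and a vector orthogonal to it
is an eigenvector of `H` for the nonreal number `z̄`, hence zero. -/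
theorem exists_graph_eq (hH : IsSelfAdjoint H) {z : ℂ} (hz : z.im ≠ 0) (f : 𝓗) :
    ∃ u w, (u, w) ∈ H.graph ∧ w - z • u = f := by
  let L : 𝓗 × 𝓗 →ₗ[ℂ] 𝓗 := LinearMap.snd ℂ 𝓗 𝓗 - z • LinearMap.fst ℂ 𝓗 𝓗
  let R : Submodule ℂ 𝓗 := H.graph.map L
  have hR : IsClosed (R : Set 𝓗) := by
    rw [isClosed_iff_clusterPt]
    intro y hy
    rw [← mem_closure_iff_clusterPt, mem_closure_iff_seq_limit] at hy
    obtain ⟨s, hs, hlim⟩ := hy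
    choose p hp hps using hs
    have hpos := abs_pos.2 hz
    have hc : CauchySeq fun n => (p n).1 := by
      rw [Metric.cauchySeq_iff]
      intro ε hε
      obtain ⟨N, hN⟩ := Metric.cauchySeq_iff.1 hlim.cauchySeq (|z.im| * ε) (by positivity)
      refine ⟨N, fun m hm n hn => ?_⟩
      have h1 := hN m hm n hn
      have h2 := norm_graph_le hH (H.graph.sub_mem (hp m) (hp n)) z
      have h3 : ((p m).2 - (p n).2) - z • ((p m).1 - (p n).1) = s m - s n := by
        rw [← hps m, ← hps n]; simp [L, smul_sub]; abel
      rw [h3, ← dist_eq_norm, ← dist_eq_norm] at h2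
      exact lt_of_mul_lt_mul_left (h2.trans_lt h1) hpos.le
    obtain ⟨u, hu⟩ := cauchySeq_tendsto_of_complete hc
    have hw : Tendsto (fun n => (p n).2) atTop (𝓝 (y + z • u)) := by
      refine (hlim.add (hu.const_smul z)).congr fun n => ?_
      rw [← hps n]; simp [L]
    have hmem := hH.isClosed.mem_of_tendsto (hu.prodMk_nhds hw) (Eventually.of_forall hp)
    exact ⟨_, hmem, by simp [L]⟩
  have hbot : Rᗮ = ⊥ := by
    rw [Submodule.eq_bot_iff]
    intro v hv
    rw [Submodule.mem_orthogonal] at hv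
    have hg : (v, (starRingEnd ℂ) z • v) ∈ H.graph := by
      refine mem_graph_of_forall_inner hH fun u w huw => ?_
      have h1 := hv _ (Submodule.mem_map_of_mem (f := L) huw)
      simp only [L, LinearMap.sub_apply, LinearMap.smul_apply, LinearMap.snd_apply,
        LinearMap.fst_apply, inner_sub_left, inner_smul_left, sub_eq_zero] at h1
      rw [h1, inner_smul_right]
    refine eq_of_graph hH (z := (starRingEnd ℂ) z) (by simpa using hz) hg H.graph.zero_mem ?_
    simp
  have htop : R = ⊤ := by
    have h1 := Submodule.topologicalClosure_eq_top_iff.2 hbot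
    rwa [hR.submodule_topologicalClosure_eq] at h1
  have hf : f ∈ R := htop ▸ Submodule.mem_top
  obtain ⟨⟨u, w⟩, h, he⟩ := hf
  exact ⟨u, w, h, by simpa [L] using he⟩

end SelfAdjoint

/-! ### The resolvent form as a Stieltjes transform. -/

namespace SpectralMeasure

variable {𝓗 : Type*} [NormedAddCommGroup 𝓗] [InnerProductSpace ℂ 𝓗] [CompleteSpace 𝓗]
variable {E : SpectralMeasure 𝓗} {H : 𝓗 →ₗ.[ℂ] 𝓗}

theorem hasSum_iUnion_int (E : SpectralMeasure 𝓗) {S : ℤ → Set ℝ}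
    (hS : ∀ n, MeasurableSet (S n)) (hd : Pairwise (Function.onFun Disjoint S)) (f : 𝓗) :
    HasSum (fun n => E (S n) f) (E (⋃ n, S n) f) := by
  have e := (Denumerable.eqv ℤ).symm
  rw [← e.hasSum_iff, ← e.surjective.iUnion_comp]
  exact E.hasSum_iUnion (fun n => S (e n)) (fun n => hS _)
    (fun m n hmn => hd (e.injective.ne hmn)) f

theorem integral_id_scalar_add_compl (hE : E.IsSpectralMeasureOf H) {S : Set ℝ}
    (hS : MeasurableSet S) {u v : 𝓗} (hu : u ∈ H.domain) (hv : v ∈ H.domain) :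
    ∫ t, t ∂(E.scalar (E S u + E Sᶜ v))
      = ∫ t, t ∂(E.scalar (E S u)) + ∫ t, t ∂(E.scalar (E Sᶜ v)) := by
  rw [scalar_add_compl E hS, integral_add_measure (hE.integrable_id hu).restrict
    (hE.integrable_id hv).restrict, scalar_map E hS, scalar_map E hS.compl]

/-- The form `∫ t d(E(t)x, x)` is additive over the orthogonal parts `E S u` and `E Sᶜ v`, so the
cross terms of `(x, H x)` cancel. By symmetry they are conjugate to each other, so the real part of
either vanishes. -/
theorem inner_graph_compl (hE : E.IsSpectralMeasureOf H) (hH : IsSelfAdjoint H) {S : Set ℝ}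
    (hS : MeasurableSet S) {u v w : 𝓗} (hu : u ∈ H.domain) (hw : (E S u, w) ∈ H.graph)
    (hv : v ∈ H.domain) : inner ℂ (E Sᶜ v) w = 0 := by
  have key : ∀ v ∈ H.domain, (inner ℂ (E Sᶜ v) w).re = 0 := by
    intro v hv
    obtain ⟨y, hy⟩ := exists_mem_graph (hE.map_mem_domain hS.compl hv)
    have h1 := hE.inner_graph (H.graph.add_mem hw hy)
    rw [integral_id_scalar_add_compl hE hS hu hv, Complex.ofReal_add, ← hE.inner_graph hw,
      ← hE.inner_graph hy, inner_add_left, inner_add_right, inner_add_right] at h1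
    have h2 : inner ℂ (E S u) y + inner ℂ (E Sᶜ v) w = 0 := by linear_combination h1
    rw [← inner_graph_symm hH hw hy, ← inner_conj_symm] at h2
    have h3 := congrArg Complex.re h2
    simp only [Complex.add_re, Complex.conj_re, Complex.zero_re] at h3
    linarith
  have h1 := key v hv
  -- Replacing `v` by `i v` turns the statement on real parts into one on imaginary parts.
  have h2 := key (Complex.I • v) (H.domain.smul_mem _ hv)
  rw [map_smul, inner_smul_left] at h2
  apply Complex.ext
  · simpa using h1
  · simpa using h2

/-- `IsSpectralMeasureOf` only prescribes the domain and the quadratic form of `H`; this recovers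
from them that `H` commutes with the spectral projections. -/
theorem map_mem_graph (hE : E.IsSpectralMeasureOf H) (hH : IsSelfAdjoint H) {S : Set ℝ}
    (hS : MeasurableSet S) {u w : 𝓗} (h : (u, w) ∈ H.graph) : (E S u, E S w) ∈ H.graph := by
  have hu : u ∈ H.domain := LinearPMap.mem_domain_of_mem_graph h
  have key : ∀ T, MeasurableSet T → ∀ y, (E T u, y) ∈ H.graph → E Tᶜ y = 0 := by
    intro T hT y hy
    apply hH.dense_domain.eq_zero_of_inner_right ℂ
    intro v hv
    rw [← inner_apply_left E hT.compl]
    exact inner_graph_compl hE hH hT hu hy hv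
  obtain ⟨w₁, h₁⟩ := exists_mem_graph (hE.map_mem_domain hS hu)
  obtain ⟨w₂, h₂⟩ := exists_mem_graph (hE.map_mem_domain hS.compl hu)
  have h3 := H.graph.add_mem h₁ h₂
  rw [Prod.mk_add_mk, apply_add_compl E hS] at h3
  have h4 : w = w₁ + w₂ := LinearPMap.mem_graph_snd_inj _ h h3 rfl
  have h5 := key S hS w₁ h₁
  have h6 := key Sᶜ hS.compl w₂ h₂
  rw [compl_compl] at h6
  have h7 := apply_add_compl E hS w₁
  rw [h5, add_zero] at h7
  rw [h4, map_add, h6, add_zero, h7]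
  exact h₁

theorem scalar_eq_restrict (E : SpectralMeasure 𝓗) {S : Set ℝ} (hS : MeasurableSet S) {x : 𝓗}
    (hx : E S x = x) : E.scalar x = (E.scalar x).restrict S := by
  conv_lhs => rw [← hx]
  exact scalar_map E hS x

theorem mem_domain_of_bounded (hE : E.IsSpectralMeasureOf H) {S : Set ℝ}
    (hS : MeasurableSet S) {a b : ℝ} (hSab : S ⊆ Icc a b) {x : 𝓗} (hx : E S x = x) :
    x ∈ H.domain := by
  rw [hE.mem_domain_iff, scalar_eq_restrict E hS hx]
  refine Integrable.of_bound (by fun_prop) ((|a| + |b|) ^ 2) ?_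
  refine (ae_restrict_mem hS).mono fun t ht => ?_
  obtain ⟨h1, h2⟩ := hSab ht
  rw [Real.norm_of_nonneg (sq_nonneg t), ← sq_abs t]
  gcongr
  rw [abs_le]
  constructor
  · linarith [neg_abs_le a, abs_nonneg b]
  · linarith [le_abs_self b, abs_nonneg a]

theorem norm_inner_graph_sub_le (hE : E.IsSpectralMeasureOf H) {S : Set ℝ}
    (hS : MeasurableSet S) {c δ : ℝ} (hSc : S ⊆ Icc (c - δ) (c + δ)) {v y : 𝓗}
    (hv : E S v = v) (h : (v, y) ∈ H.graph) :
    ‖inner ℂ v (y - (c : ℂ) • v)‖ ≤ δ * ‖v‖ ^ 2 := by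
  have hint := hE.integrable_id (LinearPMap.mem_domain_of_mem_graph h)
  have hμ : (E.scalar v).real univ = ‖v‖ ^ 2 := by
    rw [scalar_real E v MeasurableSet.univ, map_univ_apply]
  have h1 : inner ℂ v (y - (c : ℂ) • v) = ((∫ t, (t - c) ∂(E.scalar v) : ℝ) : ℂ) := by
    rw [inner_sub_right, inner_smul_right, hE.inner_graph h, inner_self_eq_norm_sq_to_K,
      integral_sub hint (integrable_const c), integral_const, hμ]
    push_cast
    simp [mul_comm]
  rw [h1, Complex.norm_real, ← hμ]
  refine norm_integral_le_of_norm_le_const ?_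
  rw [scalar_eq_restrict E hS hv]
  refine (ae_restrict_mem hS).mono fun t ht => ?_
  obtain ⟨h1, h2⟩ := hSc ht
  rw [Real.norm_eq_abs, abs_le]
  constructor <;> linarith

/-- A symmetric operator whose quadratic form is bounded by `δ` has norm at most `δ`. With `a = (H -
c) x`, the forms at `x ± δ⁻¹ a` differ by `4 δ⁻¹ ‖a‖²`, and the parallelogram law bounds this by `2δ
(‖x‖² + δ⁻² ‖a‖²)`. The weight `δ⁻¹` balances the two terms. -/
theorem norm_graph_sub_le (hE : E.IsSpectralMeasureOf H) (hH : IsSelfAdjoint H) {S : Set ℝ}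
    (hS : MeasurableSet S) {c δ : ℝ} (hδ : 0 < δ) (hSc : S ⊆ Icc (c - δ) (c + δ)) {x w : 𝓗}
    (hx : E S x = x) (h : (x, w) ∈ H.graph) : ‖w - (c : ℂ) • x‖ ≤ δ * ‖x‖ := by
  have hw : E S w = w := by
    have := map_mem_graph hE hH hS h
    rw [hx] at this
    exact LinearPMap.mem_graph_snd_inj _ this h rfl
  set a := w - (c : ℂ) • x with ha
  have haS : E S a = a := by rw [ha, map_sub, map_smul, hw, hx]
  obtain ⟨y, hy⟩ := exists_mem_graph (mem_domain_of_bounded hE hS hSc haS)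
  set r : ℂ := ((δ⁻¹ : ℝ) : ℂ) with hr
  have hp := norm_inner_graph_sub_le hE hS hSc (v := x + r • a) (y := w + r • y)
    (by rw [map_add, map_smul, hx, haS]) (H.graph.add_mem h (H.graph.smul_mem r hy))
  have hm := norm_inner_graph_sub_le hE hS hSc (v := x - r • a) (y := w - r • y)
    (by rw [map_sub, map_smul, hx, haS]) (H.graph.sub_mem h (H.graph.smul_mem r hy))
  have hxa : inner ℂ x (y - (c : ℂ) • a) = inner ℂ a a := by
    rw [inner_sub_right, ← inner_graph_symm hH h hy, inner_smul_right]
    conv_rhs => rw [ha]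
    rw [← ha, inner_sub_left, inner_smul_left, Complex.conj_ofReal]
  have hdiff : inner ℂ (x + r • a) (w + r • y - (c : ℂ) • (x + r • a))
      - inner ℂ (x - r • a) (w - r • y - (c : ℂ) • (x - r • a)) = 4 * r * inner ℂ a a := by
    have e1 : w + r • y - (c : ℂ) • (x + r • a) = a + r • (y - (c : ℂ) • a) := by
      rw [ha]; module
    have e2 : w - r • y - (c : ℂ) • (x - r • a) = a - r • (y - (c : ℂ) • a) := by
      rw [ha]; module
    rw [e1, e2]
    simp only [inner_add_left, inner_add_right, inner_sub_left (𝕜 := ℂ) x,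
      inner_sub_right (𝕜 := ℂ) _ a, inner_smul_right (𝕜 := ℂ) _ (y - (c : ℂ) • a),
      inner_smul_left (𝕜 := ℂ) a, hxa]
    rw [hr, Complex.conj_ofReal]
    ring
  have hpar := parallelogram_law_with_norm ℂ x (r • a)
  have hn := (norm_sub_le (inner ℂ (x + r • a) (w + r • y - (c : ℂ) • (x + r • a)))
    (inner ℂ (x - r • a) (w - r • y - (c : ℂ) • (x - r • a)))).trans (add_le_add hp hm)
  have hrn : ‖r‖ = δ⁻¹ := by rw [hr, Complex.norm_real, Real.norm_of_nonneg (by positivity)]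
  have haa : ‖inner ℂ a a‖ = ‖a‖ ^ 2 := by
    rw [inner_self_eq_norm_sq_to_K, norm_pow, RCLike.norm_ofReal, abs_norm]
  rw [hdiff, norm_mul, norm_mul, haa, hrn, Complex.norm_ofNat, ← mul_add, hpar, norm_smul,
    hrn] at hn
  have h2 : ‖a‖ ^ 2 ≤ (δ * ‖x‖) ^ 2 := by
    have h4 : δ * (2 * (‖x‖ ^ 2 + (δ⁻¹ * ‖a‖) ^ 2))
        = 2 * δ * ‖x‖ ^ 2 + 2 * δ⁻¹ * ‖a‖ ^ 2 := by
      field_simp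
    rw [h4] at hn
    have h5 : δ⁻¹ * ‖a‖ ^ 2 ≤ δ * ‖x‖ ^ 2 := by linarith
    calc ‖a‖ ^ 2 = δ * (δ⁻¹ * ‖a‖ ^ 2) := by field_simp
      _ ≤ δ * (δ * ‖x‖ ^ 2) := by gcongr
      _ = _ := by ring
  exact (sq_le_sq₀ (norm_nonneg _) (by positivity)).1 h2

end SpectralMeasure

theorem norm_inv_ofReal_sub_le {z : ℂ} (hz : z.im ≠ 0) (x : ℝ) :
    ‖((x : ℂ) - z)⁻¹‖ ≤ |z.im|⁻¹ := by
  rw [norm_inv]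
  have h := Complex.abs_im_le_norm ((x : ℂ) - z)
  simp only [Complex.sub_im, Complex.ofReal_im, zero_sub, abs_neg] at h
  exact inv_anti₀ (abs_pos.2 hz) h

theorem ofReal_sub_ne_zero {z : ℂ} (hz : z.im ≠ 0) (x : ℝ) : (x : ℂ) - z ≠ 0 := by
  intro h
  apply hz
  have := congrArg Complex.im h
  simpa using this

theorem continuous_inv_ofReal_sub {z : ℂ} (hz : z.im ≠ 0) :
    Continuous fun x : ℝ => ((x : ℂ) - z)⁻¹ :=
  (Complex.continuous_ofReal.sub continuous_const).inv₀ (ofReal_sub_ne_zero hz)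

theorem integrable_inv_ofReal_sub {z : ℂ} (hz : z.im ≠ 0) (μ : Measure ℝ) [IsFiniteMeasure μ] :
    Integrable (fun x : ℝ => ((x : ℂ) - z)⁻¹) μ :=
  Integrable.of_bound (continuous_inv_ofReal_sub hz).aestronglyMeasurable _
    (ae_of_all _ (norm_inv_ofReal_sub_le hz))

namespace SpectralMeasure

variable {𝓗 : Type*} [NormedAddCommGroup 𝓗] [InnerProductSpace ℂ 𝓗] [CompleteSpace 𝓗]
variable {E : SpectralMeasure 𝓗} {H : 𝓗 →ₗ.[ℂ] 𝓗}

/-- On a small cell `S` around `c` both quantities are close to `(c - z)⁻¹ ‖E S f‖²`, each with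
error `δ |Im z|⁻² ‖E S f‖²`. The factor `‖E S f‖²` keeps the errors summable over a partition. -/
theorem norm_inner_resolvent_sub_le (hE : E.IsSpectralMeasureOf H) (hH : IsSelfAdjoint H) {z : ℂ}
    (hz : z.im ≠ 0) {u w f : 𝓗} (h : (u, w) ∈ H.graph) (hf : w - z • u = f) {S : Set ℝ}
    (hS : MeasurableSet S) {c δ : ℝ} (hδ : 0 < δ) (hSc : S ⊆ Icc (c - δ) (c + δ)) :
    ‖inner ℂ f (E S u) - ∫ x in S, ((x : ℂ) - z)⁻¹ ∂(E.scalar f)‖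
      ≤ 2 * δ * |z.im|⁻¹ ^ 2 * ‖E S f‖ ^ 2 := by
  set m := |z.im|⁻¹ with hm
  have hm0 : 0 ≤ m := by positivity
  have hg := map_mem_graph hE hH hS h
  have hfS : E S w - z • E S u = E S f := by rw [← hf, map_sub, map_smul]
  have h1 := norm_graph_sub_le hE hH hS hδ hSc (apply_apply_self E hS u) hg
  have h2 : ‖E S u‖ ≤ m * ‖E S f‖ := by
    have := norm_graph_le hH hg z
    rw [hfS] at this
    rw [hm, inv_mul_eq_div, le_div_iff₀ (abs_pos.2 hz), mul_comm]
    exact this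
  have hcz := ofReal_sub_ne_zero hz c
  have h3 : ‖inner ℂ f (E S u) - ((c : ℂ) - z)⁻¹ * ((‖E S f‖ ^ 2 : ℝ) : ℂ)‖
      ≤ δ * m ^ 2 * ‖E S f‖ ^ 2 := by
    have e : inner ℂ f (E S u) - ((c : ℂ) - z)⁻¹ * ((‖E S f‖ ^ 2 : ℝ) : ℂ)
        = - (((c : ℂ) - z)⁻¹ * inner ℂ (E S f) (E S w - (c : ℂ) • E S u)) := by
      have e1 : E S w - (c : ℂ) • E S u = E S f - ((c : ℂ) - z) • E S u := by
        rw [← hfS]; module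
      rw [e1, inner_sub_right, inner_smul_right, inner_self_eq_norm_sq_to_K,
        inner_apply_left E hS, apply_apply_self E hS]
      push_cast
      field_simp
      simp
    rw [e, norm_neg, norm_mul]
    calc _ ≤ m * (‖E S f‖ * (δ * (m * ‖E S f‖))) := by
          gcongr
          · exact norm_inv_ofReal_sub_le hz c
          · refine (norm_inner_le_norm _ _).trans ?_
            gcongr
            refine h1.trans ?_
            gcongr
      _ = _ := by ring
  have h4 : ‖((c : ℂ) - z)⁻¹ * ((‖E S f‖ ^ 2 : ℝ) : ℂ)
      - ∫ x in S, ((x : ℂ) - z)⁻¹ ∂(E.scalar f)‖ ≤ δ * m ^ 2 * ‖E S f‖ ^ 2 := by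
    have e : ((c : ℂ) - z)⁻¹ * ((‖E S f‖ ^ 2 : ℝ) : ℂ)
        = ∫ x in S, ((c : ℂ) - z)⁻¹ ∂(E.scalar f) := by
      rw [setIntegral_const, scalar_real E f hS, Complex.real_smul, mul_comm]
    rw [e, ← integral_sub (integrable_const _) (integrable_inv_ofReal_sub hz _),
      ← scalar_real E f hS]
    refine norm_setIntegral_le_of_norm_le_const (measure_lt_top _ _) fun x hx => ?_
    have hxz := ofReal_sub_ne_zero hz x
    rw [inv_sub_inv hcz hxz, div_eq_mul_inv, mul_inv, norm_mul, norm_mul]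
    have hxc : ‖(x : ℂ) - z - ((c : ℂ) - z)‖ ≤ δ := by
      rw [sub_sub_sub_cancel_right, ← Complex.ofReal_sub, Complex.norm_real, Real.norm_eq_abs,
        abs_le]
      obtain ⟨h5, h6⟩ := hSc hx
      constructor <;> linarith
    calc _ ≤ δ * (m * m) := by
          gcongr
          · exact norm_inv_ofReal_sub_le hz c
          · exact norm_inv_ofReal_sub_le hz x
      _ = _ := by ring
  calc _ ≤ _ := norm_sub_le_norm_sub_add_norm_sub _ (((c : ℂ) - z)⁻¹ * ((‖E S f‖ ^ 2 : ℝ) : ℂ)) _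
    _ ≤ _ := add_le_add h3 h4
    _ = _ := by ring

/-- Cut the line into cells of length `δ` and sum the cell estimates: the squares `‖E Sₙ f‖²` add up
to `‖f‖²`, so the total error is `O(δ)`. -/
theorem inner_resolvent_eq_integral (hE : E.IsSpectralMeasureOf H) (hH : IsSelfAdjoint H) {z : ℂ}
    (hz : z.im ≠ 0) {u w f : 𝓗} (h : (u, w) ∈ H.graph) (hf : w - z • u = f) :
    inner ℂ f u = ∫ x, ((x : ℂ) - z)⁻¹ ∂(E.scalar f) := by
  have key : ∀ δ : ℝ, 0 < δ → ‖inner ℂ f u - ∫ x, ((x : ℂ) - z)⁻¹ ∂(E.scalar f)‖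
      ≤ 2 * δ * |z.im|⁻¹ ^ 2 * ‖f‖ ^ 2 := by
    intro δ hδ
    let S : ℤ → Set ℝ := fun n => Ico (n • δ) ((n + 1) • δ)
    have hS : ∀ n, MeasurableSet (S n) := fun n => measurableSet_Ico
    have hd : Pairwise (Function.onFun Disjoint S) := pairwise_disjoint_Ico_zsmul δ
    have hU : ⋃ n, S n = univ := iUnion_Ico_zsmul hδ
    have hu := (hasSum_iUnion_int E hS hd u).mapL (innerSL ℂ f)
    have hfsum := ((hasSum_iUnion_int E hS hd f).mapL (innerSL ℂ f)).mapL Complex.reCLM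
    have hint := hasSum_integral_iUnion (μ := E.scalar f) hS hd
      (integrable_inv_ofReal_sub hz (E.scalar f)).integrableOn
    rw [hU, map_univ_apply, innerSL_apply_apply] at hu
    rw [hU, map_univ_apply, innerSL_apply_apply] at hfsum
    rw [hU, setIntegral_univ] at hint
    have hfe : Complex.reCLM (inner ℂ f f) = ‖f‖ ^ 2 := by
      rw [inner_self_eq_norm_sq_to_K]; norm_cast
    rw [hfe] at hfsum
    refine (hu.sub hint).norm_le_of_bounded (hfsum.mul_left (2 * δ * |z.im|⁻¹ ^ 2)) fun n => ?_
    have hb := norm_inner_resolvent_sub_le hE hH hz h hf (hS n) (c := n • δ) hδ (by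
      intro x hx
      obtain ⟨h1, h2⟩ := hx
      rw [add_smul, one_smul] at h2
      exact ⟨by linarith, h2.le⟩)
    refine hb.trans (le_of_eq ?_)
    rw [innerSL_apply_apply, inner_apply_self E (hS n), Complex.reCLM_apply, Complex.ofReal_re]
  rw [← sub_eq_zero, ← norm_le_zero_iff]
  have hlim : Tendsto (fun δ : ℝ => 2 * δ * |z.im|⁻¹ ^ 2 * ‖f‖ ^ 2) (𝓝[>] 0) (𝓝 0) := by
    have : Tendsto (fun δ : ℝ => 2 * δ * |z.im|⁻¹ ^ 2 * ‖f‖ ^ 2) (𝓝 0)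
        (𝓝 (2 * 0 * |z.im|⁻¹ ^ 2 * ‖f‖ ^ 2)) := by
      apply Continuous.tendsto
      fun_prop
    simpa using this.mono_left nhdsWithin_le_nhds
  exact ge_of_tendsto hlim (eventually_mem_nhdsWithin.mono fun δ hδ => key δ hδ)

end SpectralMeasure

/-! ### Stieltjes inversion at a point. -/

section StieltjesInversion

theorem hasDerivAt_arctan_sub_div {ε : ℝ} (hε : 0 < ε) (x s : ℝ) :
    HasDerivAt (fun s => Real.arctan ((s - x) / ε)) (ε / ((x - s) ^ 2 + ε ^ 2)) s := by
  have h := (((hasDerivAt_id s).sub_const x).div_const ε).arctan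
  refine h.congr_deriv ?_
  have h1 : (x - s) ^ 2 + ε ^ 2 ≠ 0 := by positivity
  have h2 : 1 + ((s - x) / ε) ^ 2 ≠ 0 := by positivity
  simp only [id]
  field_simp
  ring

theorem continuous_poisson {ε : ℝ} (hε : 0 < ε) :
    Continuous fun p : ℝ × ℝ => ε / ((p.2 - p.1) ^ 2 + ε ^ 2) := by
  refine continuous_const.div (by fun_prop) fun p => ?_
  positivity

theorem integral_poisson {ε : ℝ} (hε : 0 < ε) (x a b : ℝ) :
    ∫ s in a..b, ε / ((x - s) ^ 2 + ε ^ 2)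
      = Real.arctan ((b - x) / ε) - Real.arctan ((a - x) / ε) := by
  refine intervalIntegral.integral_eq_sub_of_hasDerivAt
    (fun s _ => hasDerivAt_arctan_sub_div hε x s) (Continuous.intervalIntegrable ?_ _ _)
  exact (continuous_poisson hε).comp (continuous_id.prodMk continuous_const)

theorem tendsto_arctan_div (y : ℝ) :
    Tendsto (fun ε : ℝ => Real.arctan (y / ε)) (𝓝[>] 0) (𝓝 (Real.pi / 2 * SignType.sign y)) := by
  rcases lt_trichotomy y 0 with h | h | h
  · simp only [div_eq_mul_inv, sign_neg h, SignType.coe_neg, SignType.coe_one, mul_neg, mul_one]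
    exact (Real.tendsto_arctan_atBot.mono_right nhdsWithin_le_nhds).comp
      (tendsto_inv_nhdsGT_zero.const_mul_atTop_of_neg h)
  · simp [h]
  · simp only [div_eq_mul_inv, sign_pos h, SignType.coe_one, mul_one]
    exact (Real.tendsto_arctan_atTop.mono_right nhdsWithin_le_nhds).comp
      (tendsto_inv_nhdsGT_zero.const_mul_atTop h)

variable {μ : Measure ℝ} [IsFiniteMeasure μ]

theorem integral_integral_poisson {ε : ℝ} (hε : 0 < ε) (a b : ℝ) :
    ∫ s in a..b, ∫ x, ε / ((x - s) ^ 2 + ε ^ 2) ∂μ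
      = ∫ x, (Real.arctan ((b - x) / ε) - Real.arctan ((a - x) / ε)) ∂μ := by
  have : IsFiniteMeasure (volume.restrict (uIoc a b)) := ⟨by
    rw [Measure.restrict_apply_univ, uIoc]; exact measure_Ioc_lt_top⟩
  rw [MeasureTheory.intervalIntegral_integral_swap]
  · simp_rw [integral_poisson hε]
  · refine Integrable.of_bound (continuous_poisson hε).aestronglyMeasurable ε⁻¹
      (ae_of_all _ fun p => ?_)
    simp only [Function.uncurry]
    rw [Real.norm_of_nonneg (by positivity), div_le_iff₀ (by positivity), inv_mul_eq_div,
      le_div_iff₀ hε]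
    nlinarith [sq_nonneg (p.2 - p.1)]

theorem tendsto_integral_integral_poisson (a b : ℝ) :
    Tendsto (fun ε : ℝ => ∫ s in a..b, ∫ x, ε / ((x - s) ^ 2 + ε ^ 2) ∂μ) (𝓝[>] 0)
      (𝓝 (∫ x, (Real.pi / 2 * SignType.sign (b - x) - Real.pi / 2 * SignType.sign (a - x)) ∂μ)) := by
  have h : Tendsto (fun ε : ℝ => ∫ x, (Real.arctan ((b - x) / ε) - Real.arctan ((a - x) / ε)) ∂μ)
      (𝓝[>] 0) (𝓝 (∫ x, (Real.pi / 2 * SignType.sign (b - x)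
        - Real.pi / 2 * SignType.sign (a - x)) ∂μ)) := by
    refine tendsto_integral_filter_of_dominated_convergence (fun _ => Real.pi) ?_ ?_
      (integrable_const _) (ae_of_all _ fun x =>
        (tendsto_arctan_div (b - x)).sub (tendsto_arctan_div (a - x)))
    · exact Eventually.of_forall fun ε => by
        have := Real.continuous_arctan
        exact Continuous.aestronglyMeasurable (by fun_prop)
    · refine Eventually.of_forall fun ε => ae_of_all _ fun x => ?_
      rw [Real.norm_eq_abs, abs_le]
      have h1 := Real.arctan_lt_pi_div_two ((b - x) / ε)
      have h2 := Real.arctan_lt_pi_div_two ((a - x) / ε)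
      have h3 := Real.neg_pi_div_two_lt_arctan ((b - x) / ε)
      have h4 := Real.neg_pi_div_two_lt_arctan ((a - x) / ε)
      constructor <;> linarith
  refine h.congr' (eventually_mem_nhdsWithin.mono fun ε hε => ?_)
  exact (integral_integral_poisson hε a b).symm

theorem sign_sub_eq_indicator (s : ℝ) :
    (fun x : ℝ => (SignType.sign (s - x) : ℝ))
      = fun x => (Iio s).indicator 1 x - (Ioi s).indicator 1 x := by
  funext x
  rcases lt_trichotomy x s with h | h | h
  · simp [sign_pos (sub_pos.2 h), h, h.le]
  · simp [h]
  · simp [sign_neg (sub_neg.2 h), h, h.le]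

theorem integral_sign_sub (s : ℝ) :
    ∫ x, Real.pi / 2 * (SignType.sign (s - x) : ℝ) ∂μ
      = Real.pi / 2 * (μ.real (Iio s) - μ.real (Ioi s)) := by
  rw [integral_const_mul]
  rw [sign_sub_eq_indicator, integral_sub ((integrable_const _).indicator measurableSet_Iio)
    ((integrable_const _).indicator measurableSet_Ioi),
    integral_indicator_one measurableSet_Iio, integral_indicator_one measurableSet_Ioi]

theorem integrable_sign_sub (s : ℝ) :
    Integrable (fun x => Real.pi / 2 * (SignType.sign (s - x) : ℝ)) μ := by
  refine Integrable.const_mul (Integrable.of_bound ?_ 1 (ae_of_all _ fun x => ?_)) _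
  · rw [sign_sub_eq_indicator]
    exact (((measurable_const).indicator measurableSet_Iio).sub
      ((measurable_const).indicator measurableSet_Ioi)).aestronglyMeasurable
  · rcases lt_trichotomy (s - x) 0 with h | h | h <;> simp [h]

/-- Integrate the pointwise estimate over `s` between `a` and `b` at fixed `ε`, then let `ε ↓ 0`.
The Poisson kernel integrates to a difference of arctangents, which tend to `π/2` times signs; this
produces the symmetrized distribution function. -/
theorem norm_measure_sub_le {t d δ η : ℝ} (hη : 0 < η)
    (h : ∀ s ∈ Metric.ball t η, ∀ ε ∈ Ioo 0 η,
      |(∫ x, ε / ((x - s) ^ 2 + ε ^ 2) ∂μ) - d| ≤ δ)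
    {a b : ℝ} (ha : a ∈ Metric.ball t η) (hb : b ∈ Metric.ball t η) :
    |Real.pi / 2 * (μ.real (Iio b) - μ.real (Ioi b))
      - Real.pi / 2 * (μ.real (Iio a) - μ.real (Ioi a)) - d * (b - a)| ≤ δ * |b - a| := by
  have hlim := tendsto_integral_integral_poisson (μ := μ) a b
  rw [integral_sub (integrable_sign_sub b) (integrable_sign_sub a), integral_sign_sub,
    integral_sign_sub] at hlim
  refine le_of_tendsto (hlim.sub_const (d * (b - a))).abs ?_
  filter_upwards [Ioo_mem_nhdsGT hη] with ε hε
  have hc : IntervalIntegrable (fun s => ∫ x, ε / ((x - s) ^ 2 + ε ^ 2) ∂μ) volume a b := by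
    refine Continuous.intervalIntegrable ?_ a b
    refine continuous_of_dominated (bound := fun _ => ε⁻¹) (fun s => ?_) (fun s => ?_)
      (integrable_const _) (ae_of_all _ fun x => ?_)
    · exact ((continuous_poisson hε.1).comp
        (continuous_const.prodMk continuous_id)).aestronglyMeasurable
    · refine ae_of_all _ fun x => ?_
      have := hε.1
      rw [Real.norm_of_nonneg (by positivity), div_le_iff₀ (by positivity), inv_mul_eq_div,
        le_div_iff₀ hε.1]
      nlinarith [sq_nonneg (x - s)]
    · exact (continuous_poisson hε.1).comp (continuous_id.prodMk continuous_const)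
  have e : (∫ s in a..b, ∫ x, ε / ((x - s) ^ 2 + ε ^ 2) ∂μ) - d * (b - a)
      = ∫ s in a..b, ((∫ x, ε / ((x - s) ^ 2 + ε ^ 2) ∂μ) - d) := by
    rw [intervalIntegral.integral_sub hc intervalIntegrable_const,
      intervalIntegral.integral_const, smul_eq_mul, mul_comm]
  rw [e]
  rw [← Real.norm_eq_abs]
  refine intervalIntegral.norm_integral_le_of_norm_le_const fun s hs => ?_
  rw [Real.norm_eq_abs]
  refine h s ?_ ε hε
  have := (Real.ball_eq_Ioo t η ▸ ordConnected_Ioo : (Metric.ball t η).OrdConnected).uIcc_subset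
    ha hb
  exact this (uIoc_subset_uIcc hs)

/-- To the right of an atom at `s` the symmetrized distribution function has risen by at least `π/2
· μ{s}`, which a Lipschitz bound forbids. -/
theorem measure_singleton_eq_zero_of_lipschitz {t C η : ℝ}
    (h : ∀ a ∈ Metric.ball t η, ∀ b ∈ Metric.ball t η,
      |Real.pi / 2 * (μ.real (Iio b) - μ.real (Ioi b))
        - Real.pi / 2 * (μ.real (Iio a) - μ.real (Ioi a))| ≤ C * |b - a|)
    {s : ℝ} (hs : s ∈ Metric.ball t η) : μ.real {s} = 0 := by
  have hlim : Tendsto (fun b : ℝ => C * |b - s|) (𝓝[>] s) (𝓝 0) := by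
    have : Tendsto (fun b : ℝ => C * |b - s|) (𝓝 s) (𝓝 (C * |s - s|)) := by
      apply Continuous.tendsto; fun_prop
    simpa using this.mono_left nhdsWithin_le_nhds
  have key : Real.pi / 2 * μ.real {s} ≤ 0 := by
    refine ge_of_tendsto hlim ?_
    filter_upwards [self_mem_nhdsWithin,
      mem_nhdsWithin_of_mem_nhds (Metric.isOpen_ball.mem_nhds hs)] with b hb hbt
    refine le_trans ?_ ((le_abs_self _).trans (h s hs b hbt))
    have h1 : μ.real (Iio s) + μ.real {s} ≤ μ.real (Iio b) := by
      rw [← measureReal_union (by simp) (measurableSet_singleton s)]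
      refine measureReal_mono ?_
      intro x hx
      rcases hx with hx | hx
      · exact lt_trans (mem_Iio.1 hx) (mem_Ioi.1 hb)
      · rw [mem_singleton_iff.1 hx]; exact hb
    have h2 : μ.real (Ioi b) ≤ μ.real (Ioi s) := measureReal_mono (Ioi_subset_Ioi hb.le)
    have := Real.pi_pos
    rw [← mul_sub]
    gcongr
    linarith
  have h0 : 0 ≤ μ.real {s} := measureReal_nonneg
  have := Real.pi_pos
  nlinarith

/-- Stieltjes inversion at a point: if the Poisson integrals of `μ` converge to `π d` at `t`, then
the distribution function of `μ` has derivative `d` at `t`. -/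
theorem hasDerivAt_measure_Iio_of_tendsto_poisson {t d : ℝ}
    (h : Tendsto (fun p : ℝ × ℝ => ∫ x, p.2 / ((x - p.1) ^ 2 + p.2 ^ 2) ∂μ)
      (𝓝 t ×ˢ 𝓝[>] 0) (𝓝 (Real.pi * d))) :
    HasDerivAt (fun s => μ.real (Iio s)) d t := by
  set N : ℝ → ℝ := fun s => Real.pi / 2 * (μ.real (Iio s) - μ.real (Ioi s)) with hN
  have hloc : ∀ δ > 0, ∃ η > 0, ∀ s ∈ Metric.ball t η, ∀ ε ∈ Ioo 0 η,
      |(∫ x, ε / ((x - s) ^ 2 + ε ^ 2) ∂μ) - Real.pi * d| ≤ δ := by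
    intro δ hδ
    have h1 := Metric.tendsto_nhds.1 h δ hδ
    rw [eventually_prod_iff] at h1
    obtain ⟨P, hP, Q, hQ, hPQ⟩ := h1
    obtain ⟨η₁, hη₁, hP⟩ := Metric.eventually_nhds_iff_ball.1 hP
    obtain ⟨η₂, hη₂, hQ⟩ := mem_nhdsGT_iff_exists_Ioo_subset.1 hQ
    refine ⟨min η₁ η₂, lt_min hη₁ hη₂, fun s hs ε hε => ?_⟩
    have := hPQ (hP s (Metric.ball_subset_ball (min_le_left _ _) hs))
      (hQ ⟨hε.1, hε.2.trans_le (min_le_right _ _)⟩)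
    rw [Real.dist_eq] at this
    exact this.le
  have hderiv : HasDerivAt N (Real.pi * d) t := by
    rw [hasDerivAt_iff_isLittleO, Asymptotics.isLittleO_iff]
    intro δ hδ
    obtain ⟨η, hη, hb⟩ := hloc δ hδ
    filter_upwards [Metric.ball_mem_nhds t hη] with s hs
    have := norm_measure_sub_le hη hb (Metric.mem_ball_self hη) hs
    simpa [hN, mul_comm] using this
  have hatom : ∀ᶠ s in 𝓝 t, μ.real {s} = 0 := by
    obtain ⟨η, hη, hb⟩ := hloc 1 one_pos
    filter_upwards [Metric.ball_mem_nhds t hη] with s hs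
    refine measure_singleton_eq_zero_of_lipschitz (C := 1 + |Real.pi * d|) (η := η) ?_ hs
    intro a ha b hb'
    have h1 := norm_measure_sub_le hη hb ha hb'
    have h2 := abs_sub_abs_le_abs_sub (Real.pi / 2 * (μ.real (Iio b) - μ.real (Ioi b))
        - Real.pi / 2 * (μ.real (Iio a) - μ.real (Ioi a))) (Real.pi * d * (b - a))
    rw [abs_mul (Real.pi * d)] at h2
    linarith
  -- Away from atoms `μ(Ioi s) = μ(univ) - μ(Iio s)`, so `N s = π μ(Iio s) - (π/2) μ(univ)`; this is
  -- solved for `μ(Iio s)`. The absence of atoms is needed on a whole neighbourhood of `t`.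
  have hd : HasDerivAt (fun s => (2 * Real.pi)⁻¹ * (Real.pi * μ.real univ + 2 * N s)) d t := by
    refine (((hderiv.const_mul 2).const_add (Real.pi * μ.real univ)).const_mul
      (2 * Real.pi)⁻¹).congr_deriv ?_
    have := Real.pi_ne_zero
    field_simp
  refine hd.congr_of_eventuallyEq ?_
  filter_upwards [hatom] with s hs
  have h1 : μ.real univ = μ.real (Iio s) + (μ.real {s} + μ.real (Ioi s)) := by
    rw [← measureReal_union (by simp) measurableSet_Ioi,
      ← measureReal_union _ ((measurableSet_singleton s).union measurableSet_Ioi)]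
    · congr 1
      ext x
      simp
    · simp
  have := Real.pi_ne_zero
  rw [h1, hs, hN]
  field_simp
  ring

end StieltjesInversion

/-! ### Plemelj boundary values of Cauchy integrals of Hölder functions. -/

section CauchyIntegral

variable {Z : Type*} [NormedAddCommGroup Z] [NormedSpace ℂ Z]

/-- The Cauchy integral `∫_a^b A(s) / (s - z) ds`. -/
noncomputable def cauchyIntegral (A : ℝ → Z) (a b : ℝ) (z : ℂ) : Z :=
  ∫ s in Icc a b, ((s : ℂ) - z)⁻¹ • A s

theorem integrableOn_cauchy {A : ℝ → Z} {a b : ℝ} (hA : ContinuousOn A (Icc a b)) {z : ℂ}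
    (hz : z.im ≠ 0) : IntegrableOn (fun s : ℝ => ((s : ℂ) - z)⁻¹ • A s) (Icc a b) :=
  ((continuous_inv_ofReal_sub hz).continuousOn.smul hA).integrableOn_Icc

theorem intervalIntegrable_abs_rpow {p : ℝ} (hp : -1 < p) (c : ℝ) :
    IntervalIntegrable (fun u : ℝ => |u| ^ p) volume (-c) c := by
  have h0 : ∀ c : ℝ, 0 ≤ c → IntervalIntegrable (fun u : ℝ => |u| ^ p) volume 0 c := by
    intro c hc
    refine (intervalIntegral.intervalIntegrable_rpow' hp).congr_ae ?_
    rw [uIoc_of_le hc]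
    exact (ae_restrict_mem measurableSet_Ioc).mono fun u hu => by simp only [abs_of_pos hu.1]
  have h1 : ∀ c : ℝ, IntervalIntegrable (fun u : ℝ => |u| ^ p) volume 0 c := by
    intro c
    rcases le_total 0 c with hc | hc
    · exact h0 c hc
    · have := (IntervalIntegrable.iff_comp_neg (by simp)).1 (h0 (-c) (by linarith))
      simpa using this
  exact (h1 (-c)).symm.trans (h1 c)

theorem integral_inv_sub {a b : ℝ} (hab : a ≤ b) {z : ℂ} (hz : z.im ≠ 0) :
    ∫ s in Icc a b, ((s : ℂ) - z)⁻¹ = Complex.log (b - z) - Complex.log (a - z) := by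
  rw [integral_Icc_eq_integral_Ioc, ← intervalIntegral.integral_of_le hab]
  refine intervalIntegral.integral_eq_sub_of_hasDerivAt (f := fun s : ℝ => Complex.log ((s : ℂ) - z))
    (fun s _ => ?_) ((continuous_inv_ofReal_sub hz).intervalIntegrable a b)
  have h := (Complex.ofRealCLM.hasDerivAt (x := s)).sub_const z
  have h1 := h.clog_real (Or.inr (by simpa using hz))
  simpa using h1

theorem tendsto_real_sub_add_mul_I (c t : ℝ) :
    Tendsto (fun p : ℝ × ℝ => (c : ℂ) - ((p.1 : ℂ) + (p.2 : ℂ) * Complex.I)) (𝓝 t ×ˢ 𝓝 0)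
      (𝓝 ((c : ℂ) - t)) := by
  rw [← nhds_prod_eq]
  have : Continuous fun p : ℝ × ℝ => (c : ℂ) - ((p.1 : ℂ) + (p.2 : ℂ) * Complex.I) := by fun_prop
  simpa using this.tendsto (t, 0)

theorem tendsto_log_right {b t : ℝ} (hb : t < b) :
    Tendsto (fun p : ℝ × ℝ => Complex.log ((b : ℂ) - ((p.1 : ℂ) + (p.2 : ℂ) * Complex.I)))
      (𝓝 t ×ˢ 𝓝 0) (𝓝 (Complex.log ((b : ℂ) - t))) := by
  refine (tendsto_real_sub_add_mul_I b t).clog (Or.inl ?_)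
  simpa using hb

/-- For `ε > 0` the point `a - z` reaches the cut of the logarithm from below, whence `-πi`; from
the other side the limit has `+πi`. This difference is the only source of the jump of the Cauchy
integral. -/
theorem tendsto_log_left_pos {a t : ℝ} (ha : a < t) :
    Tendsto (fun p : ℝ × ℝ => Complex.log ((a : ℂ) - ((p.1 : ℂ) + (p.2 : ℂ) * Complex.I)))
      (𝓝 t ×ˢ 𝓝[>] 0) (𝓝 (Real.log ‖(a : ℂ) - t‖ - Real.pi * Complex.I)) := by
  refine (Complex.tendsto_log_nhdsWithin_im_neg_of_re_neg_of_im_zero (z := (a : ℂ) - t)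
    (by simpa using ha) (by simp)).comp (tendsto_nhdsWithin_iff.2
      ⟨(tendsto_real_sub_add_mul_I a t).mono_left (prod_mono le_rfl nhdsWithin_le_nhds), ?_⟩)
  filter_upwards [tendsto_snd.eventually (eventually_mem_nhdsWithin (a := (0 : ℝ)) (s := Ioi 0))]
    with p hp
  simpa using hp

theorem tendsto_log_left_neg {a t : ℝ} (ha : a < t) :
    Tendsto (fun p : ℝ × ℝ => Complex.log ((a : ℂ) - ((p.1 : ℂ) + (p.2 : ℂ) * Complex.I)))
      (𝓝 t ×ˢ 𝓝[<] 0) (𝓝 (Real.log ‖(a : ℂ) - t‖ + Real.pi * Complex.I)) := by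
  refine (Complex.tendsto_log_nhdsWithin_im_nonneg_of_re_neg_of_im_zero (z := (a : ℂ) - t)
    (by simpa using ha) (by simp)).comp (tendsto_nhdsWithin_iff.2
      ⟨(tendsto_real_sub_add_mul_I a t).mono_left (prod_mono le_rfl nhdsWithin_le_nhds), ?_⟩)
  filter_upwards [tendsto_snd.eventually (eventually_mem_nhdsWithin (a := (0 : ℝ)) (s := Iio 0))]
    with p hp
  simpa using (mem_Iio.1 hp).le

variable {A : ℝ → Z} {a b t : ℝ} {C r : ℝ≥0}

/-- Subtracting the value of `A` at a point `s`, later taken to be `Re z`, tames the kernel, and the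
subtracted part integrates to logarithms. The translation by `s` pins the singularity at `u = 0`, so
that one dominating function serves all `s`. -/
theorem cauchyIntegral_eq_add (hab : a ≤ b) (hA : ContinuousOn A (Icc a b)) {z : ℂ}
    (hz : z.im ≠ 0) (s : ℝ) [CompleteSpace Z] :
    cauchyIntegral A a b z
      = (∫ u, (Icc a b).indicator (fun x : ℝ => ((x : ℂ) - z)⁻¹ • (A x - A s)) (s + u))
        + (Complex.log (b - z) - Complex.log (a - z)) • A s := by
  rw [integral_add_left_eq_self
    (fun x => (Icc a b).indicator (fun x : ℝ => ((x : ℂ) - z)⁻¹ • (A x - A s)) x) s,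
    integral_indicator measurableSet_Icc, ← integral_inv_sub hab hz]
  simp_rw [smul_sub]
  rw [integral_sub (integrableOn_cauchy hA hz) (integrableOn_cauchy continuousOn_const hz),
    integral_smul_const, cauchyIntegral, sub_add_cancel]

theorem norm_regularized_le (hA : HolderOnWith C r A (Icc a b)) {s ε : ℝ}
    (hs : s ∈ Ioo a b) (u : ℝ) :
    ‖(Icc a b).indicator (fun x : ℝ => ((x : ℂ) - ((s : ℂ) + (ε : ℂ) * Complex.I))⁻¹ • (A x - A s))
      (s + u)‖ ≤ (Icc (-(b - a)) (b - a)).indicator (fun u => (C : ℝ) * |u| ^ ((r : ℝ) - 1)) u := by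
  have hpos : ∀ u, 0 ≤ (Icc (-(b - a)) (b - a)).indicator
      (fun u => (C : ℝ) * |u| ^ ((r : ℝ) - 1)) u :=
    fun u => indicator_nonneg (fun _ _ => by positivity) u
  by_cases hu : s + u ∈ Icc a b
  · rw [indicator_of_mem hu]
    rcases eq_or_ne u 0 with rfl | h0
    · simpa using hpos 0
    have hu' : u ∈ Icc (-(b - a)) (b - a) :=
      ⟨by linarith [hu.1, hs.2], by linarith [hu.2, hs.1]⟩
    rw [indicator_of_mem hu', norm_smul, norm_inv]
    have h1 := hA.dist_le hu (Ioo_subset_Icc_self hs)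
    rw [dist_eq_norm, Real.dist_eq, add_sub_cancel_left] at h1
    have h2 : |u| ≤ ‖((s + u : ℝ) : ℂ) - ((s : ℂ) + (ε : ℂ) * Complex.I)‖ := by
      have := Complex.abs_re_le_norm (((s + u : ℝ) : ℂ) - ((s : ℂ) + (ε : ℂ) * Complex.I))
      simpa using this
    have h3 : 0 < |u| := abs_pos.2 h0
    calc _ ≤ |u|⁻¹ * (C * |u| ^ (r : ℝ)) := by gcongr
      _ = _ := by rw [Real.rpow_sub_one h3.ne']; field_simp
  · rw [indicator_of_notMem hu, norm_zero]
    exact hpos u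

theorem tendsto_regularized (hr : 0 < r) (hA : HolderOnWith C r A (Icc a b)) (ht : t ∈ Ioo a b) :
    Tendsto (fun p : ℝ × ℝ => ∫ u, (Icc a b).indicator
      (fun x : ℝ => ((x : ℂ) - ((p.1 : ℂ) + (p.2 : ℂ) * Complex.I))⁻¹ • (A x - A p.1)) (p.1 + u))
      (𝓝 t ×ˢ 𝓝[≠] 0) (𝓝 (∫ u, (Icc a b).indicator
        (fun x : ℝ => ((x : ℂ) - t)⁻¹ • (A x - A t)) (t + u))) := by
  have hcont := hA.continuousOn hr
  have hat : ContinuousAt A t := hcont.continuousAt (Icc_mem_nhds ht.1 ht.2)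
  have hfst : Tendsto (fun p : ℝ × ℝ => p.1) (𝓝 t ×ˢ 𝓝[≠] (0 : ℝ)) (𝓝 t) := tendsto_fst
  have hsnd : Tendsto (fun p : ℝ × ℝ => p.2) (𝓝 t ×ˢ 𝓝[≠] (0 : ℝ)) (𝓝 0) :=
    tendsto_snd.mono_right nhdsWithin_le_nhds
  have hmem : ∀ᶠ p : ℝ × ℝ in 𝓝 t ×ˢ 𝓝[≠] 0, p.1 ∈ Ioo a b :=
    hfst.eventually (Ioo_mem_nhds ht.1 ht.2)
  have hne : ∀ᶠ p : ℝ × ℝ in 𝓝 t ×ˢ 𝓝[≠] 0, p.2 ≠ 0 :=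
    tendsto_snd.eventually (eventually_mem_nhdsWithin (a := (0 : ℝ)) (s := {0}ᶜ))
  refine tendsto_integral_filter_of_dominated_convergence
    ((Icc (-(b - a)) (b - a)).indicator fun u => (C : ℝ) * |u| ^ ((r : ℝ) - 1)) ?_ ?_ ?_ ?_
  · filter_upwards [hne] with p hp
    have hm : AEStronglyMeasurable ((Icc a b).indicator
        (fun x : ℝ => ((x : ℂ) - ((p.1 : ℂ) + (p.2 : ℂ) * Complex.I))⁻¹ • (A x - A p.1))) volume := by
      rw [aestronglyMeasurable_indicator_iff measurableSet_Icc]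
      refine ContinuousOn.aestronglyMeasurable ?_ measurableSet_Icc
      exact (continuous_inv_ofReal_sub (by simpa using hp)).continuousOn.smul
        (hcont.sub continuousOn_const)
    exact hm.comp_measurePreserving (measurePreserving_add_left volume p.1)
  · filter_upwards [hmem] with p hp
    exact ae_of_all _ fun u => norm_regularized_le hA hp u
  · rw [integrable_indicator_iff measurableSet_Icc]
    have h0 : 0 ≤ b - a := by linarith [ht.1, ht.2]
    refine IntegrableOn.congr_fun (f := fun u => (C : ℝ) * |u| ^ ((r : ℝ) - 1)) ?_
      (fun _ _ => rfl) measurableSet_Icc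
    refine Integrable.const_mul ?_ _
    rw [← IntegrableOn, integrableOn_Icc_iff_integrableOn_Ioc,
      ← intervalIntegrable_iff_integrableOn_Ioc_of_le (by linarith)]
    refine intervalIntegrable_abs_rpow ?_ _
    have : (0 : ℝ) < r := hr
    linarith
  -- The excluded points are the singularity of the kernel and the two ends of the limiting
  -- integration interval.
  · have hnull : ∀ᵐ u : ℝ, u ∉ ({0, a - t, b - t} : Set ℝ) :=
      (Set.Finite.countable (by simp)).ae_notMem volume
    filter_upwards [hnull] with u hu
    simp only [mem_insert_iff, mem_singleton_iff, not_or] at hu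
    obtain ⟨hu0, hua, hub⟩ := hu
    have hadd : Tendsto (fun p : ℝ × ℝ => p.1 + u) (𝓝 t ×ˢ 𝓝[≠] (0 : ℝ)) (𝓝 (t + u)) :=
      hfst.add_const u
    by_cases hin : t + u ∈ Icc a b
    · have hin' : t + u ∈ Ioo a b :=
        ⟨lt_of_le_of_ne hin.1 fun h => hua (by linarith),
          lt_of_le_of_ne hin.2 fun h => hub (by linarith)⟩
      rw [indicator_of_mem hin]
      have hcu : ContinuousAt A (t + u) := hcont.continuousAt (Icc_mem_nhds hin'.1 hin'.2)
      have hden : Tendsto (fun p : ℝ × ℝ => ((p.1 + u : ℝ) : ℂ) - ((p.1 : ℂ) + (p.2 : ℂ) * Complex.I))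
          (𝓝 t ×ˢ 𝓝[≠] (0 : ℝ)) (𝓝 (((t + u : ℝ) : ℂ) - t)) := by
        have h1 := ((Complex.continuous_ofReal.tendsto _).comp hadd).sub
          (((Complex.continuous_ofReal.tendsto _).comp hfst).add
            (((Complex.continuous_ofReal.tendsto _).comp hsnd).mul_const Complex.I))
        simpa using h1
      have hlim := (hden.inv₀ (by simpa using hu0)).smul
        ((hcu.tendsto.comp hadd).sub (hat.tendsto.comp hfst))
      refine hlim.congr' ?_
      filter_upwards [hadd.eventually (Ioo_mem_nhds hin'.1 hin'.2)] with p hp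
      rw [indicator_of_mem (Ioo_subset_Icc_self hp)]
      rfl
    · rw [indicator_of_notMem hin]
      refine tendsto_const_nhds.congr' ?_
      filter_upwards [hadd.eventually (isClosed_Icc.isOpen_compl.mem_nhds hin)] with p hp
      rw [indicator_of_notMem hp]

/-- Boundary values of the Cauchy integral of a Hölder continuous function. -/
theorem exists_tendsto_cauchyIntegral [CompleteSpace Z] (hr : 0 < r)
    (hA : HolderOnWith C r A (Icc a b)) (ht : t ∈ Ioo a b) :
    ∃ Q : Z, Tendsto (fun p : ℝ × ℝ => cauchyIntegral A a b ((p.1 : ℂ) + (p.2 : ℂ) * Complex.I))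
        (𝓝 t ×ˢ 𝓝[>] 0) (𝓝 (Q + (Real.pi * Complex.I : ℂ) • A t)) ∧
      Tendsto (fun p : ℝ × ℝ => cauchyIntegral A a b ((p.1 : ℂ) + (p.2 : ℂ) * Complex.I))
        (𝓝 t ×ˢ 𝓝[<] 0) (𝓝 (Q - (Real.pi * Complex.I : ℂ) • A t)) := by
  have hcont := hA.continuousOn hr
  have hat : ContinuousAt A t := hcont.continuousAt (Icc_mem_nhds ht.1 ht.2)
  have hreg := tendsto_regularized hr hA ht
  have hlim : ∀ (l : Filter ℝ) (θ : ℂ), l ≤ 𝓝[≠] 0 →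
      Tendsto (fun p : ℝ × ℝ => Complex.log ((a : ℂ) - ((p.1 : ℂ) + (p.2 : ℂ) * Complex.I)))
        (𝓝 t ×ˢ l) (𝓝 (Real.log ‖(a : ℂ) - t‖ - θ)) →
      Tendsto (fun p : ℝ × ℝ => cauchyIntegral A a b ((p.1 : ℂ) + (p.2 : ℂ) * Complex.I))
        (𝓝 t ×ˢ l) (𝓝 ((∫ u, (Icc a b).indicator
          (fun x : ℝ => ((x : ℂ) - t)⁻¹ • (A x - A t)) (t + u))
          + (Complex.log ((b : ℂ) - t) - (Real.log ‖(a : ℂ) - t‖ - θ)) • A t)) := by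
    intro l θ hl hlog
    have h1 := (hreg.mono_left (prod_mono le_rfl hl)).add
      ((((tendsto_log_right ht.2).mono_left
        (prod_mono le_rfl (hl.trans nhdsWithin_le_nhds))).sub hlog).smul
        (hat.tendsto.comp tendsto_fst))
    refine h1.congr' ?_
    filter_upwards [tendsto_snd.eventually (hl eventually_mem_nhdsWithin)] with p hp
    exact (cauchyIntegral_eq_add (ht.1.trans ht.2).le hcont (by simpa using hp) p.1).symm
  -- The regularized integral and the real logarithms are common to both sides; only the `±πi` from
  -- `log (a - z)` differs.
  refine ⟨(∫ u, (Icc a b).indicator (fun x : ℝ => ((x : ℂ) - t)⁻¹ • (A x - A t)) (t + u))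
    + (Complex.log ((b : ℂ) - t) - Real.log ‖(a : ℂ) - t‖) • A t, ?_, ?_⟩
  · have h := hlim (𝓝[>] 0) (Real.pi * Complex.I)
      (nhdsWithin_mono _ fun x hx => (ne_of_gt hx : x ≠ 0)) (tendsto_log_left_pos ht.1)
    convert h using 2
    module
  · have h := hlim (𝓝[<] 0) (-(Real.pi * Complex.I))
      (nhdsWithin_mono _ fun x hx => (ne_of_lt hx : x ≠ 0))
      (by simpa using tendsto_log_left_neg ht.1)
    convert h using 2
    module

end CauchyIntegral

/-! ### Inverting compact perturbations of the identity on an incomplete space. -/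

section CompactPerturbation

variable {𝒳 : Type*} [NormedAddCommGroup 𝒳] [NormedSpace ℂ 𝒳]

theorem norm_le_mul_norm_one_add {S : 𝒳 →L[ℂ] 𝒳} (hn : ‖S‖ < 1) (x : 𝒳) :
    ‖x‖ ≤ (1 - ‖S‖)⁻¹ * ‖(1 + S) x‖ := by
  rw [inv_mul_eq_div, le_div_iff₀ (sub_pos.2 hn)]
  have h1 : ‖x‖ ≤ ‖(1 + S) x‖ + ‖S x‖ := by
    have := norm_sub_le ((1 + S) x) (S x)
    simpa using this
  have h2 := S.le_opNorm x
  nlinarith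

/-- The Neumann iterates `uₙ₊₁ = f - S uₙ` are Cauchy. Compactness replaces completeness: a
subsequence of `S uₙ` converges, hence so does a subsequence of the Cauchy sequence `uₙ`, and its
limit solves the equation. -/
theorem surjective_one_add_of_isCompactOperator {S : 𝒳 →L[ℂ] 𝒳} (hS : IsCompactOperator S)
    (hn : ‖S‖ < 1) : Function.Surjective (1 + S : 𝒳 →L[ℂ] 𝒳) := by
  intro f
  let u : ℕ → 𝒳 := fun n => (fun v => f - S v)^[n] 0
  have hu : ∀ n, u (n + 1) = f - S (u n) := fun n => Function.iterate_succ_apply' _ _ _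
  have hdist : ∀ n, dist (u n) (u (n + 1)) ≤ ‖f‖ * ‖S‖ ^ n := by
    intro n
    induction n with
    | zero => simp [u, dist_eq_norm]
    | succ n ih =>
      rw [hu (n + 1), hu n, dist_eq_norm, sub_sub_sub_cancel_left, ← map_sub, ← hu n]
      calc _ ≤ ‖S‖ * ‖u (n + 1) - u n‖ := S.le_opNorm _
        _ ≤ ‖S‖ * (‖f‖ * ‖S‖ ^ n) := by
          gcongr
          rwa [← dist_eq_norm, dist_comm]
        _ = _ := by ring
  have hc : CauchySeq u := cauchySeq_of_le_geometric _ _ hn hdist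
  obtain ⟨K, hK, hSK⟩ := hS.image_subset_compact_of_bounded hc.isBounded_range
  obtain ⟨y, -, φ, hφ, hlim⟩ := hK.tendsto_subseq (x := fun n => S (u n))
    fun n => hSK ⟨u n, mem_range_self n, rfl⟩
  have h1 : Tendsto (fun n => u (φ n + 1)) atTop (𝓝 (f - y)) := by
    simp_rw [hu]
    exact tendsto_const_nhds.sub hlim
  have h2 : Tendsto u atTop (𝓝 (f - y)) :=
    tendsto_nhds_of_cauchySeq_of_subseq hc
      ((tendsto_add_atTop_nat 1).comp hφ.tendsto_atTop) h1
  have h3 : Tendsto (fun n => u (n + 1)) atTop (𝓝 (f - S (f - y))) := by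
    simp_rw [hu]
    exact tendsto_const_nhds.sub ((S.continuous.tendsto _).comp h2)
  have h4 := tendsto_nhds_unique (h2.comp (tendsto_add_atTop_nat 1)) h3
  refine ⟨f - y, ?_⟩
  rw [add_apply, one_apply_eq_self]
  conv_lhs => lhs; rw [h4]
  abel

/-- On a normed space, not necessarily complete, `1 + S` is invertible for `S` compact of norm less
than one. -/
theorem isUnit_one_add_of_isCompactOperator {S : 𝒳 →L[ℂ] 𝒳} (hS : IsCompactOperator S)
    (hn : ‖S‖ < 1) : IsUnit (1 + S) := by
  have hinj : Function.Injective (1 + S : 𝒳 →L[ℂ] 𝒳) := by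
    rw [injective_iff_map_eq_zero]
    intro x hx
    have := norm_le_mul_norm_one_add hn x
    rw [hx, norm_zero, mul_zero] at this
    exact norm_le_zero_iff.1 this
  let e := LinearEquiv.ofBijective ((1 + S : 𝒳 →L[ℂ] 𝒳) : 𝒳 →ₗ[ℂ] 𝒳)
    ⟨hinj, surjective_one_add_of_isCompactOperator hS hn⟩
  let e' := e.toContinuousLinearEquivOfBounds ‖1 + S‖ (1 - ‖S‖)⁻¹ (fun x => (1 + S).le_opNorm x)
    (fun x => by
      have := norm_le_mul_norm_one_add hn (e.symm x)
      have h : (1 + S) (e.symm x) = x := e.apply_symm_apply x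
      rwa [h] at this)
  exact ⟨ContinuousLinearEquiv.toUnit e', rfl⟩

/-- From `v⁻¹ - u⁻¹ = -v⁻¹ (v - u) u⁻¹`; the smallness condition lets `‖v⁻¹‖` be absorbed, giving
`‖v⁻¹‖ ≤ 2 ‖u⁻¹‖`. -/
theorem norm_ringInverse_sub_le {R : Type*} [NormedRing R] {u v : R} (hu : IsUnit u)
    (hv : IsUnit v) (h : ‖Ring.inverse u‖ * ‖v - u‖ ≤ 1 / 2) :
    ‖Ring.inverse v - Ring.inverse u‖ ≤ 2 * ‖Ring.inverse u‖ ^ 2 * ‖v - u‖ := by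
  have e : Ring.inverse v - Ring.inverse u = - (Ring.inverse v * (v - u) * Ring.inverse u) := by
    rw [mul_sub, Ring.inverse_mul_cancel v hv, sub_mul, mul_assoc, Ring.mul_inverse_cancel u hu]
    simp
  have h1 : ‖Ring.inverse v - Ring.inverse u‖ ≤ ‖Ring.inverse v‖ * (‖v - u‖ * ‖Ring.inverse u‖) := by
    rw [e, norm_neg, mul_assoc]
    refine (norm_mul_le _ _).trans ?_
    gcongr
    exact norm_mul_le _ _
  have h2 : ‖Ring.inverse v‖ ≤ 2 * ‖Ring.inverse u‖ := by
    have h3 := norm_sub_norm_le (Ring.inverse v) (Ring.inverse u)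
    nlinarith [norm_nonneg (Ring.inverse v)]
  calc _ ≤ _ := h1
    _ ≤ 2 * ‖Ring.inverse u‖ * (‖v - u‖ * ‖Ring.inverse u‖) := by gcongr
    _ = _ := by ring

variable {α : Type*} {l : Filter α} {K : α → 𝒳 →L[ℂ] 𝒳} {K₀ : 𝒳 →L[ℂ] 𝒳}

/-- Factor `1 + K = (1 + K₀)(1 + (1 + K₀)⁻¹ (K - K₀))`; the perturbation in the second factor is
compact and eventually of norm below one. -/
theorem eventually_isUnit_one_add (hK : ∀ x, IsCompactOperator (K x)) (hK₀ : IsCompactOperator K₀)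
    (hu : IsUnit (1 + K₀)) (hlim : Tendsto K l (𝓝 K₀)) : ∀ᶠ x in l, IsUnit (1 + K x) := by
  have h0 : Tendsto (fun x => ‖Ring.inverse (1 + K₀) * (K x - K₀)‖) l (𝓝 0) := by
    have := ((hlim.sub_const K₀).const_mul (Ring.inverse (1 + K₀))).norm
    simpa using this
  filter_upwards [h0.eventually (gt_mem_nhds one_pos)] with x hx
  have hc : IsCompactOperator (Ring.inverse (1 + K₀) * (K x - K₀)) :=
    ((hK x).sub hK₀).clm_comp (Ring.inverse (1 + K₀))
  have h1 := hu.mul (isUnit_one_add_of_isCompactOperator hc hx)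
  rw [mul_add, mul_one, ← mul_assoc, Ring.mul_inverse_cancel _ hu, one_mul] at h1
  convert h1 using 1
  abel

theorem tendsto_ringInverse_one_add (hK : ∀ x, IsCompactOperator (K x))
    (hK₀ : IsCompactOperator K₀) (hu : IsUnit (1 + K₀)) (hlim : Tendsto K l (𝓝 K₀)) :
    Tendsto (fun x => Ring.inverse (1 + K x)) l (𝓝 (Ring.inverse (1 + K₀))) := by
  rw [tendsto_iff_norm_sub_tendsto_zero]
  have h0 : Tendsto (fun x => ‖(1 + K x) - (1 + K₀)‖) l (𝓝 0) := by
    have := (hlim.sub_const K₀).norm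
    simpa using this
  have h1 : Tendsto (fun x => ‖Ring.inverse (1 + K₀)‖ * ‖(1 + K x) - (1 + K₀)‖) l (𝓝 0) := by
    simpa using h0.const_mul ‖Ring.inverse (1 + K₀)‖
  have h2 : Tendsto (fun x => 2 * ‖Ring.inverse (1 + K₀)‖ ^ 2 * ‖(1 + K x) - (1 + K₀)‖) l (𝓝 0) := by
    simpa using h0.const_mul (2 * ‖Ring.inverse (1 + K₀)‖ ^ 2)
  refine squeeze_zero' (Eventually.of_forall fun _ => norm_nonneg _) ?_ h2
  filter_upwards [eventually_isUnit_one_add hK hK₀ hu hlim,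
    h1.eventually (ge_mem_nhds (show (0 : ℝ) < 1 / 2 by norm_num))] with x hx hx'
  exact norm_ringInverse_sub_le hu hx hx'

end CompactPerturbation

/-! ### Measures whose distribution function has a continuous derivative. -/

section Density

variable {μ : Measure ℝ} [IsFiniteMeasure μ] {φ : ℝ → ℝ} {a b : ℝ}

theorem monotone_measureReal_Iio : Monotone fun s => μ.real (Iio s) :=
  fun _ _ h => measureReal_mono (Iio_subset_Iio h)

theorem measureReal_Ico {c d : ℝ} (hcd : c ≤ d) :
    μ.real (Ico c d) = μ.real (Iio d) - μ.real (Iio c) := by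
  have h : Iio d = Iio c ∪ Ico c d := (Iio_union_Ico_eq_Iio hcd).symm
  rw [h, measureReal_union _ measurableSet_Ico]
  · ring
  · rw [Set.disjoint_left]
    intro x hx hx'
    exact absurd (mem_Iio.1 hx) (not_lt.2 hx'.1)

theorem measure_singleton_of_continuousAt {s : ℝ}
    (h : ContinuousAt (fun s => μ.real (Iio s)) s) : μ {s} = 0 := by
  rw [← measureReal_eq_zero_iff]
  refine le_antisymm ?_ measureReal_nonneg
  have hlim : Tendsto (fun b => μ.real (Iio b) - μ.real (Iio s)) (𝓝[>] s) (𝓝 0) := by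
    have := (h.tendsto.mono_left (nhdsWithin_le_nhds (s := Ioi s))).sub_const (μ.real (Iio s))
    simpa using this
  refine ge_of_tendsto hlim (eventually_mem_nhdsWithin.mono fun b hb => ?_)
  have hb' : s < b := hb
  rw [← measureReal_Ico hb'.le]
  exact measureReal_mono (singleton_subset_iff.2 ⟨le_rfl, hb'⟩)

theorem deriv_measureReal_nonneg {s d : ℝ} (h : HasDerivAt (fun s => μ.real (Iio s)) d s) :
    0 ≤ d := by
  rw [← h.deriv]
  exact monotone_measureReal_Iio.deriv_nonneg

theorem measure_Ico_eq_lintegral (hφ : ContinuousOn φ (Icc a b))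
    (h : ∀ s ∈ Icc a b, HasDerivAt (fun s => μ.real (Iio s)) (φ s) s) {c d : ℝ} (hcd : c ≤ d)
    (hc : a ≤ c) (hd : d ≤ b) : μ (Ico c d) = ∫⁻ s in Ico c d, ENNReal.ofReal (φ s) := by
  have hsub : Icc c d ⊆ Icc a b := Icc_subset_Icc hc hd
  have hint : IntervalIntegrable φ volume c d :=
    (hφ.mono (by rwa [uIcc_of_le hcd])).intervalIntegrable
  have hftc := intervalIntegral.integral_eq_sub_of_hasDerivAt
    (fun s hs => h s (hsub (by rwa [uIcc_of_le hcd] at hs))) hint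
  rw [← measureReal_Ico hcd, intervalIntegral.integral_of_le hcd,
    ← integral_Ico_eq_integral_Ioc] at hftc
  have hio : IntegrableOn φ (Ico c d) :=
    (hφ.mono hsub).integrableOn_Icc.mono_set Ico_subset_Icc_self
  rw [← ofReal_integral_eq_lintegral_ofReal hio, hftc, ofReal_measureReal]
  exact (ae_restrict_mem measurableSet_Ico).mono fun s hs =>
    deriv_measureReal_nonneg (h s (hsub (Ico_subset_Icc_self hs)))

theorem restrict_Icc_eq_withDensity (hab : a ≤ b) (hφ : ContinuousOn φ (Icc a b))
    (h : ∀ s ∈ Icc a b, HasDerivAt (fun s => μ.real (Iio s)) (φ s) s) :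
    μ.restrict (Icc a b)
      = (volume.restrict (Icc a b)).withDensity fun s => ENNReal.ofReal (φ s) := by
  -- Differences of `μ(Iio ·)` measure half-open intervals; the endpoint `b` carries no mass since
  -- the distribution function is continuous there.
  have h1 : μ.restrict (Icc a b) = μ.restrict (Ico a b) := by
    refine Measure.restrict_congr_set (Ico_ae_eq_Icc' ?_).symm
    exact measure_singleton_of_continuousAt (h b ⟨hab, le_rfl⟩).continuousAt
  rw [h1, Measure.restrict_congr_set (Ico_ae_eq_Icc (μ := volume) (a := a) (b := b)).symm]
  refine Measure.ext_of_Ico _ _ fun c d hcd => ?_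
  rw [withDensity_apply _ measurableSet_Ico, Measure.restrict_restrict measurableSet_Ico,
    Measure.restrict_apply measurableSet_Ico, Ico_inter_Ico]
  rcases le_total (max c a) (min d b) with hle | hle
  · exact measure_Ico_eq_lintegral hφ h hle (le_max_right _ _) (min_le_right _ _)
  · rw [Ico_eq_empty (not_lt.2 hle)]
    simp

theorem setIntegral_Icc_eq_of_hasDerivAt (hab : a ≤ b) (hφ : ContinuousOn φ (Icc a b))
    (h : ∀ s ∈ Icc a b, HasDerivAt (fun s => μ.real (Iio s)) (φ s) s) (g : ℝ → ℂ) :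
    ∫ s in Icc a b, g s ∂μ = ∫ s in Icc a b, g s * (φ s : ℂ) := by
  rw [restrict_Icc_eq_withDensity hab hφ h, integral_withDensity_eq_integral_toReal_smul₀]
  · refine setIntegral_congr_fun measurableSet_Icc fun s hs => ?_
    rw [ENNReal.toReal_ofReal (deriv_measureReal_nonneg (h s hs)), Complex.real_smul, mul_comm]
  · exact (hφ.aemeasurable measurableSet_Icc).ennreal_ofReal
  · exact ae_of_all _ fun s => ENNReal.ofReal_lt_top

end Density

/-! ### Polarization of sesquilinear forms. -/

section Forms

variable {𝒳 : Type*} [NormedAddCommGroup 𝒳] [NormedSpace ℂ 𝒳]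

theorem polarization (B : 𝒳 →L[ℂ] AntiDual 𝒳) (f g : 𝒳) :
    B f g = 4⁻¹ * (B (f + g) (f + g) - B (f - g) (f - g)
      + Complex.I * B (f + Complex.I • g) (f + Complex.I • g)
      - Complex.I * B (f - Complex.I • g) (f - Complex.I • g)) := by
  simp only [map_add, map_sub, map_smul, map_smulₛₗ, add_apply, sub_apply, smul_apply,
    Complex.conj_I, smul_eq_mul]
  ring_nf
  simp only [Complex.I_sq]
  ring

theorem ext_of_diagonal {B B' : 𝒳 →L[ℂ] AntiDual 𝒳} (h : ∀ f, B f f = B' f f) : B = B' := by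
  ext f g
  rw [polarization B f g, polarization B' f g]
  simp only [h]

end Forms

/-! ### The unperturbed resolvent in `B(𝒳, 𝒴)` and its boundary values. -/

section Resolvent

variable {𝓗 : Type*} [NormedAddCommGroup 𝓗] [InnerProductSpace ℂ 𝓗]
variable {𝒳 : Type*} [NormedAddCommGroup 𝒳] [NormedSpace ℂ 𝒳]
variable {𝒴 : Type*} [NormedAddCommGroup 𝒴] [NormedSpace ℂ 𝒴]
variable {ι : 𝒳 →L[ℂ] 𝓗} {j : 𝒴 →L[ℂ] AntiDual 𝒳} {H : 𝓗 →ₗ.[ℂ] 𝓗}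

theorem toAntiDual_apply (h : 𝓗) (g : 𝒳) : toAntiDual ι h g = inner ℂ (ι g) h := rfl

theorem isResolventRestriction_iff {P : 𝓗 →L[ℂ] 𝓗} {z : ℂ} {T : 𝒳 →L[ℂ] 𝒴} :
    IsResolventRestriction H ι j P z T ↔ ∀ f : 𝒳, ∃ u w, (u, w) ∈ H.graph ∧ P u = u ∧
      w - z • u = P (ι f) ∧ j (T f) = toAntiDual ι u := by
  constructor
  · intro h f
    obtain ⟨u, h1, h2, h3⟩ := h f
    exact ⟨u, H u, H.mem_graph u, h1, h2, h3⟩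
  · intro h f
    obtain ⟨u, w, hg, h1, h2, h3⟩ := h f
    obtain ⟨v, rfl, rfl⟩ := (LinearPMap.mem_graph_iff _).1 hg
    exact ⟨v, h1, h2, h3⟩

/-- The continuous functional `T ↦ ⟨j (T f), g⟩` on `B(𝒳, 𝒴)`. -/
noncomputable def evalForm (j : 𝒴 →L[ℂ] AntiDual 𝒳) (f g : 𝒳) : (𝒳 →L[ℂ] 𝒴) →L[ℂ] ℂ :=
  (ContinuousLinearMap.apply' ℂ (starRingEnd ℂ) g) ∘L j ∘L (ContinuousLinearMap.apply ℂ 𝒴 f)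

theorem evalForm_apply (f g : 𝒳) (T : 𝒳 →L[ℂ] 𝒴) : evalForm j f g T = j (T f) g := rfl

variable [CompleteSpace 𝓗]

theorem exists_resolvent (hH : IsSelfAdjoint H) {z : ℂ} (hz : z.im ≠ 0) :
    ∃ R : 𝓗 →L[ℂ] 𝓗, ∀ f, (R f, f + z • R f) ∈ H.graph := by
  have hex : ∀ f, ∃ u, (u, f + z • u) ∈ H.graph := by
    intro f
    obtain ⟨u, w, h, he⟩ := exists_graph_eq hH hz f
    exact ⟨u, by rwa [← he, sub_add_cancel]⟩
  choose R hR using hex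
  have huniq : ∀ {u f}, (u, f + z • u) ∈ H.graph → R f = u := fun {u f} h =>
    eq_of_graph hH hz (hR f) h (by simp)
  let L : 𝓗 →ₗ[ℂ] 𝓗 :=
    { toFun := R
      map_add' := fun f g => huniq (by
        have := H.graph.add_mem (hR f) (hR g)
        rw [Prod.mk_add_mk] at this
        convert this using 2
        module)
      map_smul' := fun c f => huniq (by
        have := H.graph.smul_mem c (hR f)
        rw [Prod.smul_mk] at this
        rwa [smul_add, smul_comm c z] at this) }
  refine ⟨L.mkContinuous |z.im|⁻¹ fun f => ?_, hR⟩
  have := norm_graph_le hH (hR f) z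
  rw [add_sub_cancel_right] at this
  rw [inv_mul_eq_div, le_div_iff₀ (abs_pos.2 hz), mul_comm]
  exact this

variable {E : SpectralMeasure 𝓗}

theorem IsResolventRestriction.unique (hH : IsSelfAdjoint H) (hj : Function.Injective j) {z : ℂ}
    (hz : z.im ≠ 0) {P : 𝓗 →L[ℂ] 𝓗} {T T' : 𝒳 →L[ℂ] 𝒴} (h : IsResolventRestriction H ι j P z T)
    (h' : IsResolventRestriction H ι j P z T') : T = T' := by
  ext f
  obtain ⟨u, w, hg, -, h2, h3⟩ := isResolventRestriction_iff.1 h f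
  obtain ⟨u', w', hg', -, h2', h3'⟩ := isResolventRestriction_iff.1 h' f
  have := eq_of_graph hH hz hg hg' (h2.trans h2'.symm)
  exact hj (by rw [h3, h3', this])

theorem resolventXY_eq (hH : IsSelfAdjoint H) (hj : Function.Injective j) {z : ℂ}
    (hz : z.im ≠ 0) {T : 𝒳 →L[ℂ] 𝒴} (h : IsResolventRestriction H ι j 1 z T) :
    resolventXY H ι j z = T := by
  have hex : ∃ T : 𝒳 →L[ℂ] 𝒴, IsResolventRestriction H ι j 1 z T := ⟨T, h⟩
  rw [resolventXY, dif_pos hex]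
  exact hex.choose_spec.unique hH hj hz h

variable {J : Set ℝ} {A : ℝ → 𝒳 →L[ℂ] 𝒴} {a b t : ℝ}

theorem SpectralMeasure.apply_Iio_sub (E : SpectralMeasure 𝓗) {s s' : ℝ} (h : s ≤ s') (f : 𝓗) :
    E (Iio s') f = E (Iio s) f + E (Ico s s') f := by
  rw [← Iio_union_Ico_eq_Iio h]
  refine E.apply_union measurableSet_Iio measurableSet_Ico ?_ f
  rw [Set.disjoint_left]
  intro x hx hx'
  exact absurd (mem_Iio.1 hx) (not_lt.2 hx'.1)

/-- Taking adjoints turns `P_ac E(J) = E(J)` into `E(J) P_ac = E(J)`, and `E S` factors through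
`E(J)`. -/
theorem SpectralMeasure.apply_acProjection (hJ : MeasurableSet J)
    (hac : E.acProjection ∘L E J = E J) {S : Set ℝ} (hS : MeasurableSet S) (hSJ : S ⊆ J) (f : 𝓗) :
    E S (E.acProjection f) = E S f := by
  have hsa : ContinuousLinearMap.adjoint E.acProjection = E.acProjection := by
    unfold SpectralMeasure.acProjection
    have : CompleteSpace E.acSubspace :=
      (Submodule.isClosed_topologicalClosure _).completeSpace_coe
    exact isSelfAdjoint_starProjection _
  have h1 := congrArg ContinuousLinearMap.adjoint hac
  rw [ContinuousLinearMap.adjoint_comp, hsa, E.adjoint_apply hJ] at h1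
  have h2 : E S = E S ∘L E J := by
    ext x
    rw [ContinuousLinearMap.comp_apply, E.apply_apply hS hJ, inter_eq_left.2 hSJ]
  conv_lhs => rw [h2]
  conv_rhs => rw [h2]
  exact congrArg (E S) (congrArg (fun T : 𝓗 →L[ℂ] 𝓗 => T f) h1)

/-- On intervals inside `J` the increments of `E(s)` absorb `P_ac`, so `E(s)` and `E(s) P_ac` differ
locally by a constant. -/
theorem hasWeakDerivAt_of_acProjection (hJ : IsOpen J) (hac : E.acProjection ∘L E J = E J)
    (ht : t ∈ J) {B : 𝒳 →L[ℂ] AntiDual 𝒳}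
    (h : HasWeakDerivAt ι (fun s => E (Iio s) ∘L E.acProjection) B t) :
    HasWeakDerivAt ι (fun s => E (Iio s)) B t := by
  intro f g
  obtain ⟨η, hη, hball⟩ := Metric.isOpen_iff.1 hJ t ht
  have hconst : ∀ s s', s ≤ s' → Icc s s' ⊆ J →
      E (Iio s') (ι f) - E (Iio s') (E.acProjection (ι f))
        = E (Iio s) (ι f) - E (Iio s) (E.acProjection (ι f)) := by
    intro s s' hs hsub
    rw [E.apply_Iio_sub hs, E.apply_Iio_sub hs, SpectralMeasure.apply_acProjection
      hJ.measurableSet hac measurableSet_Ico (Ico_subset_Icc_self.trans hsub)]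
    abel
  have hsub : ∀ s ∈ Metric.ball t η, uIcc t s ⊆ J := fun s hs =>
    ((Real.ball_eq_Ioo t η ▸ ordConnected_Ioo : (Metric.ball t η).OrdConnected).uIcc_subset
      (Metric.mem_ball_self hη) hs).trans hball
  have hev : (fun s => inner ℂ (ι g) (E (Iio s) (ι f))) =ᶠ[𝓝 t] fun s =>
      inner ℂ (ι g) (E (Iio s) (E.acProjection (ι f)))
        + inner ℂ (ι g) (E (Iio t) (ι f) - E (Iio t) (E.acProjection (ι f))) := by
    filter_upwards [Metric.ball_mem_nhds t hη] with s hs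
    have h1 := hsub s hs
    rw [← inner_add_right]
    congr 1
    rcases le_total t s with hle | hle
    · rw [uIcc_of_le hle] at h1
      rw [← hconst t s hle h1]; abel
    · rw [uIcc_of_ge hle] at h1
      rw [hconst s t hle h1]; abel
  exact ((h f g).add_const _).congr_of_eventuallyEq hev

theorem hasDerivAt_scalar_Iio {B : 𝒳 →L[ℂ] AntiDual 𝒳}
    (h : HasWeakDerivAt ι (fun s => E (Iio s)) B t) (f : 𝒳) :
    HasDerivAt (fun s => (E.scalar (ι f)).real (Iio s)) (B f f).re t ∧ (B f f).im = 0 := by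
  have e : (fun s => inner ℂ (ι f) (E (Iio s) (ι f)))
      = fun s => (((E.scalar (ι f)).real (Iio s) : ℝ) : ℂ) := by
    funext s
    rw [E.inner_apply_self measurableSet_Iio, E.scalar_real _ measurableSet_Iio]
  have h1 := h f f
  simp only [e] at h1
  have hre := Complex.reCLM.hasFDerivAt.comp_hasDerivAt t h1
  have him := Complex.imCLM.hasFDerivAt.comp_hasDerivAt t h1
  refine ⟨hre, him.unique ?_⟩
  have : (Complex.imCLM ∘ fun s => (((E.scalar (ι f)).real (Iio s) : ℝ) : ℂ)) = fun _ => 0 := by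
    funext s; simp
  rw [this]
  exact hasDerivAt_const t 0

variable [CompleteSpace 𝒴]

theorem cauchyIntegral_form (hA : ContinuousOn A (Icc a b)) {z : ℂ} (hz : z.im ≠ 0) (f g : 𝒳) :
    j (cauchyIntegral A a b z f) g = ∫ s in Icc a b, ((s : ℂ) - z)⁻¹ * j (A s f) g := by
  rw [← evalForm_apply, cauchyIntegral,
    ← ContinuousLinearMap.integral_comp_comm _ (integrableOn_cauchy hA hz)]
  simp only [map_smul, smul_eq_mul, evalForm_apply]

/-- The Cauchy integral of `A` over `[a, b]` represents `R(z) E([a, b])`. On the diagonal, the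
resolvent form is a Stieltjes transform of a scalar measure whose density on `[a, b]` is `⟨A(s) f,
f⟩`. -/
theorem comp_cauchyIntegral_eq (hH : IsSelfAdjoint H) (hE : E.IsSpectralMeasureOf H)
    (hab : a ≤ b) (hA : ContinuousOn A (Icc a b))
    (hderiv : ∀ s ∈ Icc a b, HasWeakDerivAt ι (fun s => E (Iio s)) (j ∘L A s) s) {z : ℂ}
    (hz : z.im ≠ 0) {R : 𝓗 →L[ℂ] 𝓗} (hR : ∀ f, (R f, f + z • R f) ∈ H.graph) :
    j ∘L cauchyIntegral A a b z = toAntiDual ι ∘L E (Icc a b) ∘L R ∘L ι := by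
  refine ext_of_diagonal fun f => ?_
  have hK : MeasurableSet (Icc a b) := measurableSet_Icc
  have hg := E.map_mem_graph hE hH hK (hR (ι f))
  have h1 := E.inner_resolvent_eq_integral hE hH hz hg (f := E (Icc a b) (ι f))
    (by rw [map_add, map_smul, add_sub_cancel_right])
  rw [E.scalar_map hK, setIntegral_Icc_eq_of_hasDerivAt (φ := fun s => (j (A s f) f).re) hab
    (Complex.continuous_re.comp_continuousOn ((evalForm j f f).continuous.comp_continuousOn hA))
    (fun s hs => (hasDerivAt_scalar_Iio (hderiv s hs) f).1)] at h1
  rw [E.inner_apply_left hK, E.apply_apply_self hK] at h1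
  rw [ContinuousLinearMap.comp_apply, cauchyIntegral_form hA hz]
  simp only [ContinuousLinearMap.comp_apply]
  rw [toAntiDual_apply, h1]
  refine setIntegral_congr_fun hK fun s hs => ?_
  congr 1
  apply Complex.ext
  · simp
  · simpa using (hasDerivAt_scalar_Iio (hderiv s hs) f).2

theorem isResolventRestriction_add (hH : IsSelfAdjoint H) (hE : E.IsSpectralMeasureOf H)
    (hab : a ≤ b) (hA : ContinuousOn A (Icc a b))
    (hderiv : ∀ s ∈ Icc a b, HasWeakDerivAt ι (fun s => E (Iio s)) (j ∘L A s) s) {z : ℂ}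
    (hz : z.im ≠ 0) {S : 𝒳 →L[ℂ] 𝒴} (hS : IsResolventRestriction H ι j (E (Icc a b)ᶜ) z S) :
    IsResolventRestriction H ι j 1 z (S + cauchyIntegral A a b z) := by
  obtain ⟨R, hR⟩ := exists_resolvent hH hz
  have hF := comp_cauchyIntegral_eq hH hE hab hA hderiv hz hR
  rw [isResolventRestriction_iff] at hS ⊢
  intro f
  have hK : MeasurableSet (Icc a b) := measurableSet_Icc
  refine ⟨R (ι f), ι f + z • R (ι f), hR _, rfl, by simp, ?_⟩
  obtain ⟨u, w, hg, -, h2, h3⟩ := hS f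
  have hu : u = E (Icc a b)ᶜ (R (ι f)) := by
    refine eq_of_graph hH hz hg (E.map_mem_graph hE hH hK.compl (hR (ι f))) ?_
    rw [h2, map_add, map_smul, add_sub_cancel_right]
  have h4 : j (cauchyIntegral A a b z f) = toAntiDual ι (E (Icc a b) (R (ι f))) :=
    congrArg (fun T : 𝒳 →L[ℂ] AntiDual 𝒳 => T f) hF
  rw [add_apply, map_add, h3, h4, hu, ← map_add, add_comm (E (Icc a b)ᶜ _),
    E.apply_add_compl hK]

/-- Near a point of `J` the resolvent in `B(𝒳, 𝒴)` exists and has boundary values `Q ± π i A`. -/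
theorem exists_boundary_values (hj : Function.Injective j) (hH : IsSelfAdjoint H)
    (hE : E.IsSpectralMeasureOf H) (hJ : IsOpen J) (hac : E.acProjection ∘L E J = E J)
    (hA : ∀ t ∈ J, HasWeakDerivAt ι (fun s => E (Iio s) ∘L E.acProjection) (j ∘L A t) t)
    (hA_holder : LocallyHolderOn A J) (hreg : OffSpectrumRegular H E ι j J) (ht : t ∈ J) :
    (∀ z : ℂ, z.im ≠ 0 → IsResolventRestriction H ι j 1 z (resolventXY H ι j z)) ∧
    ∃ Q : 𝒳 →L[ℂ] 𝒴,
      Tendsto (fun p : ℝ × ℝ => resolventXY H ι j ((p.1 : ℂ) + (p.2 : ℂ) * Complex.I))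
        (𝓝 t ×ˢ 𝓝[>] 0) (𝓝 (Q + (Real.pi * Complex.I : ℂ) • A t)) ∧
      Tendsto (fun p : ℝ × ℝ => resolventXY H ι j ((p.1 : ℂ) + (p.2 : ℂ) * Complex.I))
        (𝓝 t ×ˢ 𝓝[<] 0) (𝓝 (Q - (Real.pi * Complex.I : ℂ) • A t)) := by
  obtain ⟨U, hU, C, r, hr, hhol⟩ := hA_holder t ht
  obtain ⟨δ, hδ, hball⟩ := Metric.nhds_basis_closedBall.mem_iff.1
    (inter_mem hU (hJ.mem_nhds ht))
  rw [Real.closedBall_eq_Icc] at hball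
  set a := t - δ
  set b := t + δ
  have hab : a < b := by simp only [a, b]; linarith
  have htab : t ∈ Ioo a b := ⟨by simp only [a]; linarith, by simp only [b]; linarith⟩
  have hKJ : Icc a b ⊆ J := hball.trans inter_subset_right
  have hhol' := hhol.mono hball
  have hderiv : ∀ s ∈ Icc a b, HasWeakDerivAt ι (fun s => E (Iio s)) (j ∘L A s) s := fun s hs =>
    hasWeakDerivAt_of_acProjection hJ hac (hKJ hs) (hA s (hKJ hs))
  obtain ⟨S, hScont, hS⟩ := hreg a b hab hKJ
  have hres : ∀ z : ℂ, z.im ≠ 0 →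
      IsResolventRestriction H ι j 1 z (S z + cauchyIntegral A a b z) := fun z hz =>
    isResolventRestriction_add hH hE hab.le (hhol'.continuousOn hr) hderiv hz (hS z (Or.inl hz))
  have heq : ∀ z : ℂ, z.im ≠ 0 → resolventXY H ι j z = S z + cauchyIntegral A a b z :=
    fun z hz => resolventXY_eq hH hj hz (hres z hz)
  refine ⟨fun z hz => (heq z hz).symm ▸ hres z hz, ?_⟩
  obtain ⟨Q, hp, hm⟩ := exists_tendsto_cauchyIntegral hr hhol' htab
  have hz : Tendsto (fun p : ℝ × ℝ => (p.1 : ℂ) + (p.2 : ℂ) * Complex.I) (𝓝 t ×ˢ 𝓝 0)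
      (𝓝 (t : ℂ)) := by
    rw [← nhds_prod_eq]
    have : Continuous fun p : ℝ × ℝ => (p.1 : ℂ) + (p.2 : ℂ) * Complex.I := by fun_prop
    simpa using this.tendsto (t, 0)
  have hlim : ∀ l : Filter ℝ, l ≤ 𝓝[≠] 0 → ∀ T : 𝒳 →L[ℂ] 𝒴,
      Tendsto (fun p : ℝ × ℝ => cauchyIntegral A a b ((p.1 : ℂ) + (p.2 : ℂ) * Complex.I))
        (𝓝 t ×ˢ l) (𝓝 T) →
      Tendsto (fun p : ℝ × ℝ => resolventXY H ι j ((p.1 : ℂ) + (p.2 : ℂ) * Complex.I))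
        (𝓝 t ×ˢ l) (𝓝 (S t + T)) := by
    intro l hl T hT
    have hne : ∀ᶠ p : ℝ × ℝ in 𝓝 t ×ˢ l,
        ((p.1 : ℂ) + (p.2 : ℂ) * Complex.I).im ≠ 0 := by
      filter_upwards [tendsto_snd.eventually (hl eventually_mem_nhdsWithin)] with p hp
      simpa using hp
    -- The part of the resolvent off `[a, b]` is continuous across the real axis at `t`, so it
    -- contributes the same limit from above and below.
    have hSt : Tendsto (fun p : ℝ × ℝ => S ((p.1 : ℂ) + (p.2 : ℂ) * Complex.I))
        (𝓝 t ×ˢ l) (𝓝 (S t)) :=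
      (hScont t (Or.inr (by simpa using htab))).tendsto.comp (tendsto_nhdsWithin_iff.2
        ⟨hz.mono_left (prod_mono le_rfl (hl.trans nhdsWithin_le_nhds)),
          hne.mono fun p hp => Or.inl hp⟩)
    exact (hSt.add hT).congr' (hne.mono fun p hp => (heq _ hp).symm)
  refine ⟨S t + Q, ?_, ?_⟩
  · rw [add_assoc]
    exact hlim _ (nhdsWithin_mono _ fun x hx => (ne_of_gt hx : x ≠ 0)) _ hp
  · rw [add_sub_assoc]
    exact hlim _ (nhdsWithin_mono _ fun x hx => (ne_of_lt hx : x ≠ 0)) _ hm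

end Resolvent

/-! ### The perturbed resolvent and its spectral density. -/

theorem tendsto_apply {𝕜 M N : Type*} [NontriviallyNormedField 𝕜] {σ : 𝕜 →+* 𝕜}
    [RingHomIsometric σ] [NormedAddCommGroup M] [NormedSpace 𝕜 M] [NormedAddCommGroup N]
    [NormedSpace 𝕜 N] {α : Type*} {l : Filter α} {T : α → M →SL[σ] N} {T₀ : M →SL[σ] N}
    {v : α → M} {v₀ : M} (hT : Tendsto T l (𝓝 T₀)) (hv : Tendsto v l (𝓝 v₀)) :
    Tendsto (fun x => T x (v x)) l (𝓝 (T₀ v₀)) := by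
  have h1 : Tendsto (fun x => (T x - T₀) (v x)) l (𝓝 0) := by
    refine squeeze_zero_norm (fun x => (T x - T₀).le_opNorm (v x)) ?_
    simpa using (hT.sub_const T₀).norm.mul hv.norm
  have h2 := h1.add ((T₀.continuous.tendsto v₀).comp hv)
  rw [zero_add] at h2
  refine h2.congr fun x => ?_
  simp

section Perturbed

variable {𝓗 : Type*} [NormedAddCommGroup 𝓗] [InnerProductSpace ℂ 𝓗] [CompleteSpace 𝓗]
variable {𝒳 : Type*} [NormedAddCommGroup 𝒳] [NormedSpace ℂ 𝒳]
variable {𝒴 : Type*} [NormedAddCommGroup 𝒴] [NormedSpace ℂ 𝒴]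
variable {ι : 𝒳 →L[ℂ] 𝓗} {j : 𝒴 →L[ℂ] AntiDual 𝒳} {H H' : 𝓗 →ₗ.[ℂ] 𝓗}
variable {E E' : SpectralMeasure 𝓗} {V : 𝒴 →L[ℂ] 𝒳}

theorem integral_inv_conj (μ : Measure ℝ) (z : ℂ) :
    ∫ x, ((x : ℂ) - (starRingEnd ℂ) z)⁻¹ ∂μ = (starRingEnd ℂ) (∫ x, ((x : ℂ) - z)⁻¹ ∂μ) := by
  rw [← integral_conj]
  simp

theorem im_integral_inv {μ : Measure ℝ} [IsFiniteMeasure μ] {s ε : ℝ} (hε : ε ≠ 0) :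
    (∫ x, ((x : ℂ) - ((s : ℂ) + (ε : ℂ) * Complex.I))⁻¹ ∂μ).im
      = ∫ x, ε / ((x - s) ^ 2 + ε ^ 2) ∂μ := by
  have hint := integrable_inv_ofReal_sub (z := (s : ℂ) + (ε : ℂ) * Complex.I) (by simpa using hε) μ
  have h := Complex.imCLM.integral_comp_comm hint
  rw [Complex.imCLM_apply] at h
  rw [← h]
  refine integral_congr_ae (ae_of_all _ fun x => ?_)
  simp [Complex.inv_im, Complex.normSq_apply, sq]

/-- The quadratic form of the unperturbed resolvent is the Stieltjes transform of the scalar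
spectral measure. -/
theorem form_resolventXY_eq (hE : E.IsSpectralMeasureOf H) (hH : IsSelfAdjoint H) {z : ℂ}
    (hz : z.im ≠ 0) {T : 𝒳 →L[ℂ] 𝒴} (hT : IsResolventRestriction H ι j 1 z T) (p : 𝒳) :
    j (T p) p = ∫ x, ((x : ℂ) - z)⁻¹ ∂(E.scalar (ι p)) := by
  obtain ⟨u, w, hg, -, h2, h3⟩ := isResolventRestriction_iff.1 hT p
  rw [h3, toAntiDual_apply]
  exact E.inner_resolvent_eq_integral hE hH hz hg h2

/-- The perturbed resolvent `R(z)(1 + V R(z))⁻¹`. -/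
theorem form_perturbed_eq (hE' : E'.IsSpectralMeasureOf H') (hH' : IsSelfAdjoint H')
    (hH : IsSelfAdjoint H) (hsum : ExtendsSum H ι j V H') {z : ℂ} (hz : z.im ≠ 0)
    {T : 𝒳 →L[ℂ] 𝒴} (hT : IsResolventRestriction H ι j 1 z T) {p h : 𝒳} (hp : p + V (T p) = h) :
    j (T p) h = ∫ x, ((x : ℂ) - z)⁻¹ ∂(E'.scalar (ι h)) ∧
      (j (T p) h).im = (j (T p) p).im := by
  obtain ⟨u, w, hg, -, h2, h3⟩ := isResolventRestriction_iff.1 hT p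
  have h2' : w - z • u = ι p := h2
  obtain ⟨u₀, hu₀, hw₀⟩ := (LinearPMap.mem_graph_iff _).1 hg
  have hu₀ : (u₀ : 𝓗) = u := hu₀
  have hw₀ : H u₀ = w := hw₀
  obtain ⟨v, hv, hv'⟩ := hsum u₀ (T p) (by rw [h3, hu₀])
  have hg' : (u, w + ι (V (T p))) ∈ H'.graph := by
    rw [← hu₀, ← hv, ← hw₀, ← hv']
    exact H'.mem_graph v
  have h4 : w + ι (V (T p)) - z • u = ι h := by
    rw [← hp, map_add, ← h2']; abel
  -- The same vector `u` solves `(H - z) u = p` and `(H' - z) u = h`, so both imaginary parts equal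
  -- `Im z ‖u‖²`.
  have h5 := im_inner_graph hH hg z
  have h6 := im_inner_graph hH' hg' z
  rw [h2'] at h5
  rw [h4] at h6
  rw [h3, toAntiDual_apply, toAntiDual_apply]
  exact ⟨E'.inner_resolvent_eq_integral hE' hH' hz hg' h4, h6.trans h5.symm⟩

theorem add_apply_ringInverse {T : 𝒳 →L[ℂ] 𝒴} (hu : IsUnit (1 + V ∘L T)) (h : 𝒳) :
    Ring.inverse (1 + V ∘L T) h + V (T (Ring.inverse (1 + V ∘L T) h)) = h := by
  have := congrArg (fun S : 𝒳 →L[ℂ] 𝒳 => S h) (Ring.mul_inverse_cancel _ hu)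
  exact this

theorem ringInverse_apply_add {T : 𝒳 →L[ℂ] 𝒴} (hu : IsUnit (1 + V ∘L T)) (h : 𝒳) :
    Ring.inverse (1 + V ∘L T) (h + V (T h)) = h := by
  have := congrArg (fun S : 𝒳 →L[ℂ] 𝒳 => S h) (Ring.inverse_mul_cancel _ hu)
  exact this

/-- With `B± = (1 + V T±)⁻¹`, the resolvent identity gives `B₊ - B₋ = -c B₊ V D B₋`; insert it in
`T₊B₊ - T₋B₋ = c D B₊ + T₋ (B₊ - B₋)`. -/
theorem perturbed_sub_apply {Tp Tm D : 𝒳 →L[ℂ] 𝒴} {c : ℂ} (hpm : Tp - Tm = c • D)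
    (hup : IsUnit (1 + V ∘L Tp)) (hum : IsUnit (1 + V ∘L Tm)) (h : 𝒳) :
    Tp (Ring.inverse (1 + V ∘L Tp) h) - Tm (Ring.inverse (1 + V ∘L Tm) h)
      = c • (D (Ring.inverse (1 + V ∘L Tp) h)
        - Tm (Ring.inverse (1 + V ∘L Tp) (V (D (Ring.inverse (1 + V ∘L Tm) h))))) := by
  set Bp := Ring.inverse (1 + V ∘L Tp)
  set Bm := Ring.inverse (1 + V ∘L Tm)
  have hTp : ∀ x, Tp x = Tm x + c • D x := fun x => by
    rw [← smul_apply, ← hpm, sub_apply]; abel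
  have h1 : Bp h - Bm h = -(c • Bp (V (D (Bm h)))) := by
    have h2 : Bp (Bm h + V (Tm (Bm h))) = Bp h := by rw [add_apply_ringInverse hum]
    have h3 : Bp (Bm h + V (Tp (Bm h))) = Bm h := ringInverse_apply_add hup _
    rw [hTp, map_add V, ← add_assoc, map_add Bp, h2, map_smul, map_smul] at h3
    calc Bp h - Bm h = Bp h - (Bp h + c • Bp (V (D (Bm h)))) := by rw [h3]
      _ = _ := by abel
  rw [hTp, add_sub_right_comm, ← map_sub, h1, map_neg, map_smul, smul_sub]
  abel

/-- The pointwise form of the stationary representation of the perturbed spectral density. -/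
theorem perturbed_density_at (hE : E.IsSpectralMeasureOf H) (hH : IsSelfAdjoint H)
    (hE' : E'.IsSpectralMeasureOf H') (hH' : IsSelfAdjoint H') (hsum : ExtendsSum H ι j V H')
    (hV : IsCompactOperator V)
    (hres : ∀ z : ℂ, z.im ≠ 0 → IsResolventRestriction H ι j 1 z (resolventXY H ι j z))
    {t : ℝ} {Tp Tm D : 𝒳 →L[ℂ] 𝒴} (hpm : Tp - Tm = (2 * Real.pi * Complex.I : ℂ) • D)
    (hp : Tendsto (fun p : ℝ × ℝ => resolventXY H ι j ((p.1 : ℂ) + (p.2 : ℂ) * Complex.I))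
      (𝓝 t ×ˢ 𝓝[>] 0) (𝓝 Tp))
    (hm : Tendsto (fun p : ℝ × ℝ => resolventXY H ι j ((p.1 : ℂ) + (p.2 : ℂ) * Complex.I))
      (𝓝 t ×ˢ 𝓝[<] 0) (𝓝 Tm))
    (hup : IsUnit (1 + V ∘L Tp)) (hum : IsUnit (1 + V ∘L Tm)) (h : 𝒳) :
    ∃ d : ℝ, HasDerivAt (fun s => (E'.scalar (ι h)).real (Iio s)) d t ∧
      j (D (Ring.inverse (1 + V ∘L Tp) h)
        - Tm (Ring.inverse (1 + V ∘L Tp) (V (D (Ring.inverse (1 + V ∘L Tm) h))))) h = d ∧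
      j (D (Ring.inverse (1 + V ∘L Tp) h)) (Ring.inverse (1 + V ∘L Tp) h) = d := by
  set ζ : ℝ × ℝ → ℂ := fun p => (p.1 : ℂ) + (p.2 : ℂ) * Complex.I with hζ
  set T : ℝ × ℝ → 𝒳 →L[ℂ] 𝒴 := fun p => resolventXY H ι j (ζ p) with hTdef
  set B : ℝ × ℝ → 𝒳 →L[ℂ] 𝒳 := fun p => Ring.inverse (1 + V ∘L T p) with hB
  set Bp := Ring.inverse (1 + V ∘L Tp)
  set Bm := Ring.inverse (1 + V ∘L Tm)
  have hcomp : ∀ S : 𝒳 →L[ℂ] 𝒴, IsCompactOperator (V ∘L S) := fun S => hV.comp_clm S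
  have hcont : Continuous fun S : 𝒳 →L[ℂ] 𝒴 => V ∘L S :=
    (ContinuousLinearMap.compL ℂ 𝒳 𝒴 𝒳 V).continuous
  have hTres : ∀ p : ℝ × ℝ, p.2 ≠ 0 → IsResolventRestriction H ι j 1 (ζ p) (T p) :=
    fun p hp => hres _ (by simpa [hζ] using hp)
  have hform : ∀ S S₁ S₂, ∀ l : Filter (ℝ × ℝ), Tendsto T l (𝓝 S) →
      ∀ x y : ℝ × ℝ → 𝒳, Tendsto x l (𝓝 S₁) → Tendsto y l (𝓝 S₂) →
      Tendsto (fun p => j (T p (x p)) (y p)) l (𝓝 (j (S S₁) S₂)) := by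
    intro S S₁ S₂ l hT x y hx hy
    exact tendsto_apply ((j.continuous.tendsto _).comp (tendsto_apply hT hx)) hy
  have hVp : Tendsto (fun p => V ∘L T p) (𝓝 t ×ˢ 𝓝[>] 0) (𝓝 (V ∘L Tp)) :=
    (hcont.tendsto _).comp hp
  have hVm : Tendsto (fun p => V ∘L T p) (𝓝 t ×ˢ 𝓝[<] 0) (𝓝 (V ∘L Tm)) :=
    (hcont.tendsto _).comp hm
  have hBp : Tendsto (fun p => B p h) (𝓝 t ×ˢ 𝓝[>] 0) (𝓝 (Bp h)) :=
    tendsto_apply (tendsto_ringInverse_one_add (fun p => hcomp (T p)) (hcomp Tp) hup hVp)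
      tendsto_const_nhds
  have hBm : Tendsto (fun p => B p h) (𝓝 t ×ˢ 𝓝[<] 0) (𝓝 (Bm h)) :=
    tendsto_apply (tendsto_ringInverse_one_add (fun p => hcomp (T p)) (hcomp Tm) hum hVm)
      tendsto_const_nhds
  have hevp := eventually_isUnit_one_add (fun p => hcomp (T p)) (hcomp Tp) hup hVp
  have hevm := eventually_isUnit_one_add (fun p => hcomp (T p)) (hcomp Tm) hum hVm
  have hnep : ∀ᶠ p : ℝ × ℝ in 𝓝 t ×ˢ 𝓝[>] 0, 0 < p.2 :=
    tendsto_snd.eventually (eventually_mem_nhdsWithin (a := (0 : ℝ)) (s := Ioi 0))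
  have hW := hform Tp (Bp h) h _ hp _ _ hBp tendsto_const_nhds
  have hW' := hform Tm (Bm h) h _ hm _ _ hBm tendsto_const_nhds
  have hP := hform Tp (Bp h) (Bp h) _ hp _ _ hBp hBp
  have hQ := hform Tp (Bp h) (Bp h) _ hp _ _ tendsto_const_nhds tendsto_const_nhds
  have hQ' := hform Tm (Bp h) (Bp h) _ hm _ _ tendsto_const_nhds tendsto_const_nhds
  -- the reflection `ε ↦ -ε`
  have hrefl : Tendsto (fun p : ℝ × ℝ => (p.1, -p.2)) (𝓝 t ×ˢ 𝓝[>] 0) (𝓝 t ×ˢ 𝓝[<] 0) := by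
    refine tendsto_fst.prodMk (Tendsto.comp ?_ tendsto_snd)
    simpa using tendsto_neg_nhdsGT (a := (0 : ℝ))
  have hζrefl : ∀ p : ℝ × ℝ, ζ (p.1, -p.2) = (starRingEnd ℂ) (ζ p) := fun p => by simp [hζ]
  -- At conjugate points the perturbed forms are Stieltjes transforms of the same positive measure,
  -- hence conjugate; this passes to the limit.
  have hconjW : j (Tm (Bm h)) h = (starRingEnd ℂ) (j (Tp (Bp h)) h) := by
    refine tendsto_nhds_unique (hW'.comp hrefl)
      (((Complex.continuous_conj.tendsto _).comp hW).congr' ?_)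
    filter_upwards [hevp, hrefl.eventually hevm, hnep] with p h1 h2 h3
    simp only [Function.comp]
    rw [(form_perturbed_eq hE' hH' hH hsum (by simpa [hζ] using h3.ne') (hTres p h3.ne')
      (add_apply_ringInverse h1 h)).1, (form_perturbed_eq hE' hH' hH hsum
      (by simpa [hζ] using h3.ne') (hTres (p.1, -p.2) (by simpa using h3.ne'))
      (add_apply_ringInverse h2 h)).1, hζrefl, integral_inv_conj]
  -- Here the vector is frozen at its limit `Bp h`, so that both sides involve one scalar measure of
  -- `H`.
  have hconjP : j (Tm (Bp h)) (Bp h) = (starRingEnd ℂ) (j (Tp (Bp h)) (Bp h)) := by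
    refine tendsto_nhds_unique (hQ'.comp hrefl)
      (((Complex.continuous_conj.tendsto _).comp hQ).congr' ?_)
    filter_upwards [hnep] with p h3
    simp only [Function.comp]
    rw [form_resolventXY_eq hE hH (by simpa [hζ] using h3.ne') (hTres p h3.ne'),
      form_resolventXY_eq hE hH (by simpa [hζ] using h3.ne')
        (hTres (p.1, -p.2) (by simpa using h3.ne')), hζrefl, integral_inv_conj]
  -- Here the vector must vary as `B p h`: the equality of imaginary parts is exact only at each
  -- nonreal point.
  have him : (j (Tp (Bp h)) h).im = (j (Tp (Bp h)) (Bp h)).im := by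
    refine tendsto_nhds_unique ((Complex.continuous_im.tendsto _).comp hW)
      (((Complex.continuous_im.tendsto _).comp hP).congr' ?_)
    filter_upwards [hevp, hnep] with p h1 h3
    exact (form_perturbed_eq hE' hH' hH hsum (by simpa [hζ] using h3.ne') (hTres p h3.ne')
      (add_apply_ringInverse h1 h)).2.symm
  have hpoisson : Tendsto (fun p : ℝ × ℝ => ∫ x, p.2 / ((x - p.1) ^ 2 + p.2 ^ 2) ∂(E'.scalar (ι h)))
      (𝓝 t ×ˢ 𝓝[>] 0) (𝓝 (Real.pi * (Real.pi⁻¹ * (j (Tp (Bp h)) h).im))) := by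
    rw [mul_inv_cancel_left₀ Real.pi_ne_zero]
    refine ((Complex.continuous_im.tendsto _).comp hW).congr' ?_
    filter_upwards [hevp, hnep] with p h1 h3
    simp only [Function.comp]
    rw [(form_perturbed_eq hE' hH' hH hsum (by simpa [hζ] using h3.ne') (hTres p h3.ne')
      (add_apply_ringInverse h1 h)).1, im_integral_inv h3.ne']
  have hc : (2 * Real.pi * Complex.I : ℂ) ≠ 0 := by
    simp [Real.pi_ne_zero]
  have hsubim : ∀ w : ℂ, w - (starRingEnd ℂ) w
      = 2 * Real.pi * Complex.I * ((Real.pi⁻¹ * w.im : ℝ) : ℂ) := by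
    intro w
    rw [Complex.sub_conj]
    have : (Real.pi : ℂ) ≠ 0 := by exact_mod_cast Real.pi_ne_zero
    push_cast
    field_simp
  -- Both remaining identities are multiplied by `2πi`, which turns `d` into `w - w̄` and each
  -- density into a jump across the axis.
  refine ⟨Real.pi⁻¹ * (j (Tp (Bp h)) h).im, hasDerivAt_measure_Iio_of_tendsto_poisson hpoisson,
    mul_left_cancel₀ hc ?_, mul_left_cancel₀ hc ?_⟩
  · rw [← hsubim, ← hconjW, ← smul_eq_mul, ← smul_apply, ← map_smul,
      ← perturbed_sub_apply hpm hup hum, map_sub, sub_apply]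
  · rw [him, ← hsubim, ← hconjP, ← smul_eq_mul, ← smul_apply, ← map_smul, ← smul_apply, ← hpm,
      sub_apply, map_sub, sub_apply]

theorem hasWeakDerivAt_of_diagonal {B : 𝒳 →L[ℂ] AntiDual 𝒳} {t : ℝ}
    (h : ∀ f, ∃ d : ℝ, HasDerivAt (fun s => (E.scalar (ι f)).real (Iio s)) d t ∧ B f f = d) :
    HasWeakDerivAt ι (fun s => E (Iio s)) B t := by
  have hdiag : ∀ f, HasDerivAt (fun s => inner ℂ (ι f) (E (Iio s) (ι f))) (B f f) t := by
    intro f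
    obtain ⟨d, hd, he⟩ := h f
    rw [he]
    refine hd.ofReal_comp.congr_of_eventuallyEq (Eventually.of_forall fun s => ?_)
    simp only
    rw [E.inner_apply_self measurableSet_Iio, E.scalar_real _ measurableSet_Iio]
  intro f g
  rw [polarization B f g]
  have e : (fun s => inner ℂ (ι g) (E (Iio s) (ι f))) = fun s =>
      4⁻¹ * (inner ℂ (ι (f + g)) (E (Iio s) (ι (f + g)))
        - inner ℂ (ι (f - g)) (E (Iio s) (ι (f - g)))
        + Complex.I * inner ℂ (ι (f + Complex.I • g)) (E (Iio s) (ι (f + Complex.I • g)))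
        - Complex.I * inner ℂ (ι (f - Complex.I • g)) (E (Iio s) (ι (f - Complex.I • g)))) := by
    funext s
    exact polarization (toAntiDual ι ∘L E (Iio s) ∘L ι) f g
  rw [e]
  exact ((((hdiag _).sub (hdiag _)).add ((hdiag _).const_mul _)).sub
    ((hdiag _).const_mul _)).const_mul _

/-- By polarization the diagonal identity means `B f g = B₀ (S f) (S g)` for all `f`, `g`; two
factors `‖S‖` result. -/
theorem norm_le_of_diagonal {B B₀ : 𝒳 →L[ℂ] AntiDual 𝒳} {S : 𝒳 →L[ℂ] 𝒳} {M : ℝ} (hM : ‖S‖ ≤ M)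
    (h : ∀ f, B f f = B₀ (S f) (S f)) : ‖B‖ ≤ M ^ 2 * ‖B₀‖ := by
  have hM0 : 0 ≤ M := (norm_nonneg _).trans hM
  have hBS : ∀ f g, B f g = B₀ (S f) (S g) := by
    intro f g
    rw [polarization B f g, polarization B₀ (S f) (S g), ← map_smul, ← map_add, ← map_add,
      ← map_sub, ← map_sub, h, h, h, h]
  have hS : ∀ x, ‖S x‖ ≤ M * ‖x‖ := fun x => S.le_of_opNorm_le hM x
  refine ContinuousLinearMap.opNorm_le_bound _ (by positivity) fun f => ?_
  refine ContinuousLinearMap.opNorm_le_bound _ (by positivity) fun g => ?_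
  rw [hBS]
  calc _ ≤ ‖B₀ (S f)‖ * ‖S g‖ := (B₀ (S f)).le_opNorm _
    _ ≤ (‖B₀‖ * (M * ‖f‖)) * (M * ‖g‖) := by
        gcongr
        · exact (B₀.le_opNorm _).trans (by gcongr; exact hS f)
        · exact hS g
    _ = _ := by ring

end Perturbed

/-! ### Identification of the limits that define `R±`. -/

section BoundaryValues

variable {𝓗 : Type*} [NormedAddCommGroup 𝓗] [InnerProductSpace ℂ 𝓗]
variable {𝒳 : Type*} [NormedAddCommGroup 𝒳] [NormedSpace ℂ 𝒳]
variable {𝒴 : Type*} [NormedAddCommGroup 𝒴] [NormedSpace ℂ 𝒴]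
variable {ι : 𝒳 →L[ℂ] 𝓗} {j : 𝒴 →L[ℂ] AntiDual 𝒳} {H : 𝓗 →ₗ.[ℂ] 𝓗} {t : ℝ} {T : 𝒳 →L[ℂ] 𝒴}

theorem resolventPlus_eq
    (h : Tendsto (fun p : ℝ × ℝ => resolventXY H ι j ((p.1 : ℂ) + (p.2 : ℂ) * Complex.I))
      (𝓝 t ×ˢ 𝓝[>] 0) (𝓝 T)) : resolventPlus H ι j t = T :=
  (h.comp (tendsto_const_nhds.prodMk tendsto_id)).limUnder_eq

theorem resolventMinus_eq
    (h : Tendsto (fun p : ℝ × ℝ => resolventXY H ι j ((p.1 : ℂ) + (p.2 : ℂ) * Complex.I))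
      (𝓝 t ×ˢ 𝓝[<] 0) (𝓝 T)) : resolventMinus H ι j t = T := by
  refine Tendsto.limUnder_eq ?_
  have hneg : Tendsto (fun ε : ℝ => -ε) (𝓝[>] 0) (𝓝[<] 0) := by
    simpa using tendsto_neg_nhdsGT (a := (0 : ℝ))
  refine (h.comp (tendsto_const_nhds.prodMk hneg)).congr fun ε => ?_
  simp [sub_eq_add_neg]

end BoundaryValues

end SpectralPerturbation

/-! ### The proposition. -/

theorem mainTheorem7
    {𝓗 : Type*} [NormedAddCommGroup 𝓗] [InnerProductSpace ℂ 𝓗] [CompleteSpace 𝓗]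
    {𝒳 : Type*} [NormedAddCommGroup 𝒳] [NormedSpace ℂ 𝒳]
    {𝒴 : Type*} [NormedAddCommGroup 𝒴] [NormedSpace ℂ 𝒴] [CompleteSpace 𝒴]
    -- `𝒳 ⊆ 𝓗` and `𝒴 = 𝒳*_H ⊆ 𝒳*`, densely and continuously embedded
    (ι : 𝒳 →L[ℂ] 𝓗) (hι : Function.Injective ι) (hι_dense : DenseRange ι)
    (j : 𝒴 →L[ℂ] SpectralPerturbation.AntiDual 𝒳)
    (hj : Function.Injective j) (hj_dense : DenseRange j)
    -- the self-adjoint operator `H` and its spectral family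
    (H : 𝓗 →ₗ.[ℂ] 𝓗) (hH : IsSelfAdjoint H)
    (E : SpectralPerturbation.SpectralMeasure 𝓗) (hE : E.IsSpectralMeasureOf H)
    -- the spectrum of `H` in `J` is absolutely continuous, with Hölder continuous density `A`
    (J : Set ℝ) (hJ : IsOpen J) (hac : E.acProjection ∘L E J = E J)
    (A : ℝ → 𝒳 →L[ℂ] 𝒴)
    (hA : ∀ t ∈ J, SpectralPerturbation.HasWeakDerivAt ι
      (fun s => E (Set.Iio s) ∘L E.acProjection) (j ∘L A t) t)
    (hA_holder : SpectralPerturbation.LocallyHolderOn A J)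
    (hreg : SpectralPerturbation.OffSpectrumRegular H E ι j J)
    -- the perturbation `V` and the self-adjoint operator `H' = H + V` with its spectral family
    (V : 𝒴 →L[ℂ] 𝒳) (hV : SpectralPerturbation.IsShortRangeSymmetric H ι j V)
    (H' : 𝓗 →ₗ.[ℂ] 𝓗) (hH' : IsSelfAdjoint H')
    (hsum : SpectralPerturbation.ExtendsSum H ι j V H')
    (E' : SpectralPerturbation.SpectralMeasure 𝓗) (hE' : E'.IsSpectralMeasureOf H')
    -- `I + V R^±(t)` is invertible in `B(𝒳)`, with inverses bounded uniformly in `t ∈ J`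
    (hplus : ∀ t ∈ J, IsUnit (1 + V ∘L SpectralPerturbation.resolventPlus H ι j t))
    (hminus : ∀ t ∈ J, IsUnit (1 + V ∘L SpectralPerturbation.resolventMinus H ι j t))
    (hplus_bdd : ∃ M : ℝ, ∀ t ∈ J,
      ‖Ring.inverse (1 + V ∘L SpectralPerturbation.resolventPlus H ι j t)‖ ≤ M)
    (hminus_bdd : ∃ M : ℝ, ∀ t ∈ J,
      ‖Ring.inverse (1 + V ∘L SpectralPerturbation.resolventMinus H ι j t)‖ ≤ M) :
    ∃ A' : ℝ → 𝒳 →L[ℂ] SpectralPerturbation.AntiDual 𝒳,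
      (∀ t ∈ J, SpectralPerturbation.HasWeakDerivAt ι (fun s => E' (Set.Iio s)) (A' t) t) ∧
      (∃ C : ℝ, 0 < C ∧ ∀ t ∈ J, ‖A' t‖ ≤ C * ‖j ∘L A t‖) ∧
      ∀ t ∈ J, A' t =
        j ∘L (A t ∘L Ring.inverse (1 + V ∘L SpectralPerturbation.resolventPlus H ι j t)
          - SpectralPerturbation.resolventMinus H ι j t
            ∘L Ring.inverse (1 + V ∘L SpectralPerturbation.resolventPlus H ι j t)
            ∘L (V ∘L A t)
            ∘L Ring.inverse (1 + V ∘L SpectralPerturbation.resolventMinus H ι j t)) := by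
  obtain ⟨M, hM⟩ := hplus_bdd
  have key : ∀ t ∈ J, ∃ Tp Tm : 𝒳 →L[ℂ] 𝒴,
      SpectralPerturbation.resolventPlus H ι j t = Tp ∧
      SpectralPerturbation.resolventMinus H ι j t = Tm ∧
      ∀ h : 𝒳, ∃ d : ℝ, HasDerivAt (fun s => (E'.scalar (ι h)).real (Iio s)) d t ∧
        j (A t (Ring.inverse (1 + V ∘L Tp) h) - Tm (Ring.inverse (1 + V ∘L Tp)
          (V (A t (Ring.inverse (1 + V ∘L Tm) h))))) h = d ∧
        j (A t (Ring.inverse (1 + V ∘L Tp) h)) (Ring.inverse (1 + V ∘L Tp) h) = d := by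
    intro t ht
    obtain ⟨hres, Q, hp, hm⟩ := SpectralPerturbation.exists_boundary_values hj hH hE hJ hac hA
      hA_holder hreg ht
    have hTp := SpectralPerturbation.resolventPlus_eq hp
    have hTm := SpectralPerturbation.resolventMinus_eq hm
    have hup := hplus t ht
    have hum := hminus t ht
    rw [hTp] at hup
    rw [hTm] at hum
    refine ⟨_, _, hTp, hTm, SpectralPerturbation.perturbed_density_at hE hH hE' hH' hsum
      hV.compact hres ?_ hp hm hup hum⟩
    -- The jump of the unperturbed resolvent: `(Q + πi A) - (Q - πi A) = 2πi A`.
    module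
  refine ⟨fun t => j ∘L (A t ∘L Ring.inverse (1 + V ∘L SpectralPerturbation.resolventPlus H ι j t)
    - SpectralPerturbation.resolventMinus H ι j t
      ∘L Ring.inverse (1 + V ∘L SpectralPerturbation.resolventPlus H ι j t)
      ∘L (V ∘L A t)
      ∘L Ring.inverse (1 + V ∘L SpectralPerturbation.resolventMinus H ι j t)),
    -- The estimate holds with `M²`, where `M` bounds `‖(1 + V R⁺)⁻¹‖`; adding one makes the
    -- constant strictly positive.
    fun t ht => ?_, ⟨M ^ 2 + 1, by positivity, fun t ht => ?_⟩, fun _ _ => rfl⟩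
  · obtain ⟨Tp, Tm, hTp, hTm, h⟩ := key t ht
    refine SpectralPerturbation.hasWeakDerivAt_of_diagonal fun f => ?_
    obtain ⟨d, h1, h2, -⟩ := h f
    simp only [hTp, hTm]
    exact ⟨d, h1, h2⟩
  · obtain ⟨Tp, Tm, hTp, hTm, h⟩ := key t ht
    have hMt := hM t ht
    rw [hTp] at hMt
    simp only [hTp, hTm]
    refine (SpectralPerturbation.norm_le_of_diagonal (B₀ := j ∘L A t) hMt fun f => ?_).trans ?_
    · obtain ⟨d, -, h2, h3⟩ := h f
      exact h2.trans h3.symm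
    · gcongr
      linarith
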